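/- Let $m,d\ge 1$ be integers, let $\mathbb k=\mathbb C(s)$ be the field of rational functions in an indeterminate $s$, and put $t=s^m$, $q=t^d$. Let $U_q(\mathfrak{sl}_2)$ be the $\mathbb k$-algebra generated by $E,F,L,L^{-1}$ with relations $$LL^{-1}=L^{-1}L=1,\quad LE=t^{2}EL,\quad LF=t^{-2}FL,\quad EF-FE=\frac{K-K^{-1}}{q-q^{-1}},\qquad K:=L^d,$$ with coproduct $\Delta E=E\otimes K+1\otimes E$, $\Delta F=F\otimes 1+K^{-1}\otimes F$, $\Delta L=L\otimes L$ and counit $\varepsilon(E)=\varepsilon(F)=0$, $\varepsilon(L)=1$. (For $m=d=1$ this is the usual $U_q(\mathfrak{sl}_2)$ over $\mathbb C(q)$ with generators $E,F,K^{\pm1}$; in general $L=K_{H/d}$, so $d=2$ gives the version with $K_w$ for all coweights $w$, over $\mathbb C(q^{1/2m})$.) A representation is of type 1 if it is spanned by weight vectors, where $v$ has weight $n\in\mathbb Z$ if $Lv=t^nv$. Let $\widetilde{U_q(\mathfrak{sl}_2)}$ be the completion of $U_q(\mathfrak{sl}_2)$ in the weak topology generated by all matrix elements $x\mapsto f(xv)$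 of all finite-dimensional type 1 representations ($\mathbb k$ being discrete), and let $\widetilde{U_q(\mathfrak{sl}_2)\otimes U_q(\mathfrak{sl}_2)}$ be the completion of $U_q(\mathfrak{sl}_2)\otimes U_q(\mathfrak{sl}_2)$ in the weak topology generated by all matrix elements of the representations $V\otimes W$, with $V,W$ irreducible finite-dimensional of type 1. The maps $\Delta$, $\varepsilon$, $(x,y)\mapsto x\otimes y$ and the actions on finite-dimensional type 1 representations extend to the completions by continuity. An element $\sigma\in\widetilde{U_q(\mathfrak{sl}_2)}$ is grouplike if $\varepsilon(\sigma)=1$ and $\Delta(\sigma)=\sigma\otimes\sigma$. For $a\in\mathbb k^\times$ let $K_a\in\widetilde{U_q(\mathfrak{sl}_2)}$ be the unique element that acts on every vector of weight $n$ in every finite-dimensional type 1 representation as multiplication by $a^n$. Then every grouplike element $\sigma$ of $\widetilde{U_q(\mathfrak{sl}_2)}$ is equal to $K_a$ for some $a\in\mathbb k^\times$; in particular $\sigma v=a^{n}v$ for every vector $v$ of weight $n$ in a finite-dimensional type 1 representation. -/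

import Mathlib

open scoped TensorProduct

noncomputable section

namespace QuantumSL2

/-! ## The algebra `U_q(sl₂)`, its coproduct and its counit -/

/-- Names of the generators. The letter `L` stands for `K_{H/d}`, where `d` is a fixed positive
integer: `d = 1` gives the algebra generated by `E, F, K^{±1}` with `K = K_H`, and `d = 2` the
algebra generated by `E, F` and the `K_w` for `w` in the coweight lattice `ℤ · H/2`. -/
inductive Gen : Type
  | E | F | L | Linv

variable {𝕜 : Type} [Field 𝕜]

/-- The defining relations of the quantized enveloping algebra of `sl₂`, with `q = t ^ d` and
`K = L ^ d`. -/
inductive Rel (t : 𝕜ˣ) (d : ℕ) : FreeAlgebra 𝕜 Gen → FreeAlgebra 𝕜 Gen → Prop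
  | L_mul_Linv : Rel t d (FreeAlgebra.ι 𝕜 .L * FreeAlgebra.ι 𝕜 .Linv) 1
  | Linv_mul_L : Rel t d (FreeAlgebra.ι 𝕜 .Linv * FreeAlgebra.ι 𝕜 .L) 1
  | L_mul_E : Rel t d (FreeAlgebra.ι 𝕜 .L * FreeAlgebra.ι 𝕜 .E)
      ((t : 𝕜) ^ 2 • (FreeAlgebra.ι 𝕜 .E * FreeAlgebra.ι 𝕜 .L))
  | L_mul_F : Rel t d (FreeAlgebra.ι 𝕜 .L * FreeAlgebra.ι 𝕜 .F)
      (((t : 𝕜) ^ 2)⁻¹ • (FreeAlgebra.ι 𝕜 .F * FreeAlgebra.ι 𝕜 .L))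
  | E_F : Rel t d
      (FreeAlgebra.ι 𝕜 .E * FreeAlgebra.ι 𝕜 .F - FreeAlgebra.ι 𝕜 .F * FreeAlgebra.ι 𝕜 .E)
      (((t : 𝕜) ^ d - ((t : 𝕜) ^ d)⁻¹)⁻¹ •
        (FreeAlgebra.ι 𝕜 .L ^ d - FreeAlgebra.ι 𝕜 .Linv ^ d))

/-- The quantized enveloping algebra `U_q(sl₂)` over the field `𝕜`, for `q = t ^ d`, generated by
`E`, `F` and `L^{±1}`, `L = K_{H/d}`. -/
def Uq (t : 𝕜ˣ) (d : ℕ) : Type := RingQuot (Rel t d)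

instance (t : 𝕜ˣ) (d : ℕ) : Ring (Uq t d) := inferInstanceAs (Ring (RingQuot (Rel t d)))

instance (t : 𝕜ˣ) (d : ℕ) : Algebra 𝕜 (Uq t d) :=
  inferInstanceAs (Algebra 𝕜 (RingQuot (Rel t d)))

lemma pow_mul_of_mul_eq_smul {A : Type} [Ring A] [Algebra 𝕜 A] {x y : A} {c : 𝕜}
    (h : x * y = c • (y * x)) (n : ℕ) : x ^ n * y = c ^ n • (y * x ^ n) := by
  induction n with
  | zero => simp
  | succ n ih =>
    rw [pow_succ', mul_assoc, ih, mul_smul_comm, ← mul_assoc, h, smul_mul_assoc, smul_smul,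
      mul_assoc, pow_succ]

namespace Uq

variable (t : 𝕜ˣ) (d : ℕ)

/-- The image in `U_q(sl₂)` of a generator. -/
def gen (g : Gen) : Uq t d := RingQuot.mkAlgHom 𝕜 (Rel t d) (FreeAlgebra.ι 𝕜 g)

/-- The generator `E`. -/
def E : Uq t d := gen t d .E

/-- The generator `F`. -/
def F : Uq t d := gen t d .F

/-- The generator `L = K_{H/d}`. -/
def L : Uq t d := gen t d .L

/-- The inverse of `L`. -/
def Linv : Uq t d := gen t d .Linv

lemma mk_rel {x y : FreeAlgebra 𝕜 Gen} (h : Rel t d x y) :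
    (RingQuot.mkAlgHom 𝕜 (Rel t d) x : Uq t d) = RingQuot.mkAlgHom 𝕜 (Rel t d) y :=
  RingQuot.mkAlgHom_rel 𝕜 h

lemma L_mul_Linv : L t d * Linv t d = 1 :=
  (map_mul (RingQuot.mkAlgHom 𝕜 (Rel t d)) _ _).symm.trans
    ((mk_rel t d Rel.L_mul_Linv).trans (map_one (RingQuot.mkAlgHom 𝕜 (Rel t d))))

lemma Linv_mul_L : Linv t d * L t d = 1 :=
  (map_mul (RingQuot.mkAlgHom 𝕜 (Rel t d)) _ _).symm.trans
    ((mk_rel t d Rel.Linv_mul_L).trans (map_one (RingQuot.mkAlgHom 𝕜 (Rel t d))))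

lemma L_mul_E : L t d * E t d = (t : 𝕜) ^ 2 • (E t d * L t d) := by
  have h := mk_rel t d Rel.L_mul_E
  simp only [map_mul, map_smul] at h
  exact h

lemma L_mul_F : L t d * F t d = ((t : 𝕜) ^ 2)⁻¹ • (F t d * L t d) := by
  have h := mk_rel t d Rel.L_mul_F
  simp only [map_mul, map_smul] at h
  exact h

lemma E_F : E t d * F t d - F t d * E t d =
    ((t : 𝕜) ^ d - ((t : 𝕜) ^ d)⁻¹)⁻¹ • (L t d ^ d - Linv t d ^ d) := by
  have h := mk_rel t d Rel.E_F
  simp only [map_mul, map_sub, map_smul, map_pow] at h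
  exact h

lemma E_mul_Linv : E t d * Linv t d = (t : 𝕜) ^ 2 • (Linv t d * E t d) := by
  have h : Linv t d * (L t d * E t d) * Linv t d
      = Linv t d * ((t : 𝕜) ^ 2 • (E t d * L t d)) * Linv t d := by rw [L_mul_E]
  rw [← mul_assoc, Linv_mul_L, one_mul, mul_smul_comm, smul_mul_assoc, mul_assoc (Linv t d),
    mul_assoc (E t d), L_mul_Linv, mul_one] at h
  exact h

lemma Linv_mul_E : Linv t d * E t d = ((t : 𝕜) ^ 2)⁻¹ • (E t d * Linv t d) := by
  rw [E_mul_Linv, smul_smul, inv_mul_cancel₀ (pow_ne_zero _ t.ne_zero), one_smul]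

lemma Linv_pow_mul_E :
    Linv t d ^ d * E t d = (((t : 𝕜) ^ 2)⁻¹) ^ d • (E t d * Linv t d ^ d) :=
  pow_mul_of_mul_eq_smul (Linv_mul_E t d) d

lemma L_pow_mul_F : L t d ^ d * F t d = (((t : 𝕜) ^ 2)⁻¹) ^ d • (F t d * L t d ^ d) :=
  pow_mul_of_mul_eq_smul (L_mul_F t d) d

/-- The coproduct on generators: `Δ E = E ⊗ K + 1 ⊗ E`, `Δ F = F ⊗ 1 + K⁻¹ ⊗ F` and
`Δ L = L ⊗ L`, where `K = L ^ d`. -/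
def comulGen : Gen → Uq t d ⊗[𝕜] Uq t d
  | .E => E t d ⊗ₜ (L t d ^ d) + 1 ⊗ₜ E t d
  | .F => F t d ⊗ₜ 1 + (Linv t d ^ d) ⊗ₜ F t d
  | .L => L t d ⊗ₜ L t d
  | .Linv => Linv t d ⊗ₜ Linv t d

lemma comulGen_rel ⦃x y : FreeAlgebra 𝕜 Gen⦄ (h : Rel t d x y) :
    FreeAlgebra.lift 𝕜 (comulGen t d) x = FreeAlgebra.lift 𝕜 (comulGen t d) y := by
  cases h with
  | L_mul_Linv =>
    simp [comulGen, L_mul_Linv, Algebra.TensorProduct.one_def]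
  | Linv_mul_L =>
    simp [comulGen, Linv_mul_L, Algebra.TensorProduct.one_def]
  | L_mul_E =>
    simp only [map_mul, map_smul, FreeAlgebra.lift_ι_apply, comulGen, mul_add, add_mul,
      Algebra.TensorProduct.tmul_mul_tmul, L_mul_E, mul_one, one_mul, smul_add,
      TensorProduct.smul_tmul', TensorProduct.tmul_smul, ← pow_succ, ← pow_succ']
  | L_mul_F =>
    have hc : L t d * Linv t d ^ d = Linv t d ^ d * L t d := by
      have : Commute (L t d) (Linv t d) := by
        rw [Commute, SemiconjBy, L_mul_Linv, Linv_mul_L]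
      exact this.pow_right d
    simp only [map_mul, map_smul, FreeAlgebra.lift_ι_apply, comulGen, mul_add, add_mul,
      Algebra.TensorProduct.tmul_mul_tmul, L_mul_F, mul_one, one_mul, smul_add,
      TensorProduct.smul_tmul', TensorProduct.tmul_smul, hc]
  | E_F =>
    have hm : (E t d * Linv t d ^ d) ⊗ₜ[𝕜] (L t d ^ d * F t d)
        = (Linv t d ^ d * E t d) ⊗ₜ[𝕜] (F t d * L t d ^ d) := by
      rw [L_pow_mul_F, Linv_pow_mul_E, TensorProduct.tmul_smul, TensorProduct.smul_tmul']
    have e1 : (comulGen t d .E) * (comulGen t d .F) - (comulGen t d .F) * (comulGen t d .E)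
        = (E t d * F t d - F t d * E t d) ⊗ₜ[𝕜] (L t d ^ d)
          + (Linv t d ^ d) ⊗ₜ[𝕜] (E t d * F t d - F t d * E t d) := by
      simp only [comulGen, mul_add, add_mul, Algebra.TensorProduct.tmul_mul_tmul, mul_one,
        one_mul, TensorProduct.sub_tmul, TensorProduct.tmul_sub, hm]
      abel
    simp only [map_mul, map_sub, map_smul, map_pow, FreeAlgebra.lift_ι_apply]
    rw [e1, E_F]
    simp only [comulGen, Algebra.TensorProduct.tmul_pow, ← TensorProduct.smul_tmul',
      TensorProduct.tmul_smul, TensorProduct.sub_tmul, TensorProduct.tmul_sub, smul_sub]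
    abel

/-- The coproduct `Δ` of `U_q(sl₂)`. -/
def comul : Uq t d →ₐ[𝕜] Uq t d ⊗[𝕜] Uq t d :=
  RingQuot.liftAlgHom 𝕜 ⟨FreeAlgebra.lift 𝕜 (comulGen t d), comulGen_rel t d⟩

/-- The counit on generators. -/
def counitGen : Gen → 𝕜
  | .E => 0
  | .F => 0
  | .L => 1
  | .Linv => 1

lemma counitGen_rel ⦃x y : FreeAlgebra 𝕜 Gen⦄ (h : Rel t d x y) :
    FreeAlgebra.lift 𝕜 (counitGen (𝕜 := 𝕜)) x = FreeAlgebra.lift 𝕜 (counitGen (𝕜 := 𝕜)) y := by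
  cases h <;> simp [counitGen]

/-- The counit `ε` of `U_q(sl₂)`. -/
def counit : Uq t d →ₐ[𝕜] 𝕜 :=
  RingQuot.liftAlgHom 𝕜 ⟨FreeAlgebra.lift 𝕜 (counitGen (𝕜 := 𝕜)), counitGen_rel t d⟩

lemma comul_gen (g : Gen) : comul t d (gen t d g) = comulGen t d g :=
  (RingQuot.liftAlgHom_mkAlgHom_apply 𝕜 _ (comulGen_rel t d) _).trans
    (FreeAlgebra.lift_ι_apply _ _)

lemma counit_gen (g : Gen) : counit t d (gen t d g) = counitGen (𝕜 := 𝕜) g :=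
  (RingQuot.liftAlgHom_mkAlgHom_apply 𝕜 _ (counitGen_rel t d) _).trans
    (FreeAlgebra.lift_ι_apply _ _)

end Uq

/-! ## Finite-dimensional representations of type 1 -/

/-- A finite-dimensional representation of `U_q(sl₂)` of type 1: the toral generator `L = K_{H/d}`
acts diagonalizably, its eigenvalues being `q ^ (n / d) = t ^ n` with `n` an integer, the weight. -/
structure TypeOneRep (t : 𝕜ˣ) (d : ℕ) where
  /-- The underlying space. -/
  carrier : Type
  [addCommGroup : AddCommGroup carrier]
  [module : Module 𝕜 carrier]
  [finite : Module.Finite 𝕜 carrier]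
  /-- The action of `U_q(sl₂)`. -/
  ρ : Uq t d →ₐ[𝕜] Module.End 𝕜 carrier
  iSup_weight : ⨆ n : ℤ, (ρ (Uq.L t d)).eigenspace ((t : 𝕜) ^ n) = ⊤

attribute [instance] TypeOneRep.addCommGroup TypeOneRep.module TypeOneRep.finite

namespace TypeOneRep

variable {t : 𝕜ˣ} {d : ℕ}

/-- The space of vectors of weight `n`. -/
def weightSpace (V : TypeOneRep t d) (n : ℤ) : Submodule 𝕜 V.carrier :=
  (V.ρ (Uq.L t d)).eigenspace ((t : 𝕜) ^ n)

/-- `V` is irreducible: it is nonzero and has no invariant subspaces other than `0` and `V`. -/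
def IsIrreducible (V : TypeOneRep t d) : Prop :=
  Nontrivial V.carrier ∧ ∀ W : Submodule 𝕜 V.carrier,
    (∀ x : Uq t d, ∀ w ∈ W, V.ρ x w ∈ W) → W = ⊥ ∨ W = ⊤

/-- The action of `U_q(sl₂) ⊗ U_q(sl₂)` on `V ⊗ W`. -/
def tensorρ (V W : TypeOneRep t d) :
    Uq t d ⊗[𝕜] Uq t d →ₐ[𝕜] Module.End 𝕜 (V.carrier ⊗[𝕜] W.carrier) :=
  Module.endTensorEndAlgHom.comp (Algebra.TensorProduct.map V.ρ W.ρ)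

lemma tensorρ_tmul (V W : TypeOneRep t d) (x y : Uq t d) :
    tensorρ V W (x ⊗ₜ y) = TensorProduct.map (V.ρ x) (W.ρ y) := rfl

/-- The representation of `U_q(sl₂)` on `V ⊗ W`, through the coproduct. -/
def tensor (V W : TypeOneRep t d) : TypeOneRep t d where
  carrier := V.carrier ⊗[𝕜] W.carrier
  ρ := (tensorρ V W).comp (Uq.comul t d)
  iSup_weight := by
    rw [eq_top_iff, ← TensorProduct.span_tmul_eq_top, Submodule.span_le]
    rintro _ ⟨v, w, rfl⟩
    have hv : v ∈ ⨆ n : ℤ, (V.ρ (Uq.L t d)).eigenspace ((t : 𝕜) ^ n) := by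
      rw [V.iSup_weight]; trivial
    have hw : w ∈ ⨆ n : ℤ, (W.ρ (Uq.L t d)).eigenspace ((t : 𝕜) ^ n) := by
      rw [W.iSup_weight]; trivial
    rw [SetLike.mem_coe]
    induction hv using Submodule.iSup_induction' with
    | zero => simp
    | add x y _ _ hx hy => rw [TensorProduct.add_tmul]; exact add_mem hx hy
    | mem m x hx =>
      induction hw using Submodule.iSup_induction' with
      | zero => simp
      | add y z _ _ hy hz => rw [TensorProduct.tmul_add]; exact add_mem hy hz
      | mem n y hy =>
        refine Submodule.mem_iSup_of_mem (m + n) ?_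
        rw [Module.End.mem_eigenspace_iff] at hx hy ⊢
        have hL : Uq.comul t d (Uq.L t d) = Uq.L t d ⊗ₜ Uq.L t d := Uq.comul_gen t d .L
        rw [AlgHom.comp_apply, hL, tensorρ_tmul, TensorProduct.map_tmul, hx, hy,
          TensorProduct.tmul_smul, ← TensorProduct.smul_tmul', smul_smul,
          zpow_add₀ t.ne_zero, mul_comm]

variable (t d) in
/-- The trivial representation. -/
def trivialRep : TypeOneRep t d where
  carrier := 𝕜
  ρ := (Algebra.lmul 𝕜 𝕜).comp (Uq.counit t d)
  iSup_weight := by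
    rw [eq_top_iff]
    refine le_trans ?_ (le_iSup _ (0 : ℤ))
    intro x _
    have hL : Uq.counit t d (Uq.L t d) = 1 := Uq.counit_gen t d .L
    rw [Module.End.mem_eigenspace_iff, AlgHom.comp_apply, hL]
    simp

end TypeOneRep

/-! ## The completions -/

/-- A set with its discrete uniformity. -/
def Disc (X : Type) : Type := X

/-- The identity map from a set to the same set with the discrete uniformity. -/
def toDisc {X : Type} (x : X) : Disc X := x

/-- The identity map back. -/
def ofDisc {X : Type} (x : Disc X) : X := x

instance (X : Type) : UniformSpace (Disc X) := ⊥

instance (X : Type) : DiscreteUniformity (Disc X) := ⟨rfl⟩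

section Completion

variable (t : 𝕜ˣ) (d : ℕ)

/-- The weak uniformity on `U_q(sl₂)` generated by all matrix elements `x ↦ f (x v)` of all
finite-dimensional representations of type 1, the field being discrete. -/
instance : UniformSpace (Uq t d) :=
  ⨅ (V : TypeOneRep t d) (f : Module.Dual 𝕜 V.carrier) (v : V.carrier),
    UniformSpace.comap (fun x => toDisc (f (V.ρ x v))) inferInstance

/-- The weak uniformity on `U_q(sl₂) ⊗ U_q(sl₂)` generated by all matrix elements of the
representations `V ⊗ W`, where `V` and `W` are irreducible of type 1. -/
instance : UniformSpace (Uq t d ⊗[𝕜] Uq t d) :=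
  ⨅ (V : TypeOneRep t d) (W : TypeOneRep t d) (_ : V.IsIrreducible) (_ : W.IsIrreducible)
    (f : Module.Dual 𝕜 (V.carrier ⊗[𝕜] W.carrier)) (v : V.carrier ⊗[𝕜] W.carrier),
    UniformSpace.comap (fun x => toDisc (f (V.tensorρ W x v))) inferInstance

/-- The completion of `U_q(sl₂)`. -/
abbrev UqHat : Type := UniformSpace.Completion (Uq t d)

/-- The completion of `U_q(sl₂) ⊗ U_q(sl₂)`. -/
abbrev UqTensorHat : Type := UniformSpace.Completion (Uq t d ⊗[𝕜] Uq t d)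

variable {t d}

lemma uniformContinuous_matrixElement (V : TypeOneRep t d) (f : Module.Dual 𝕜 V.carrier)
    (v : V.carrier) : UniformContinuous (fun x : Uq t d => toDisc (f (V.ρ x v))) :=
  uniformContinuous_iInf_dom (i := V) <| uniformContinuous_iInf_dom (i := f) <|
    uniformContinuous_iInf_dom (i := v) uniformContinuous_comap

lemma uniformContinuous_disc_iff {X Y : Type} [UniformSpace X] {g : X → Disc Y} :
    UniformContinuous g ↔ {p : X × X | g p.1 = g p.2} ∈ uniformity X := by
  rw [UniformContinuous, DiscreteUniformity.eq_principal_setRelId (Disc Y),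
    Filter.tendsto_principal]
  rfl

lemma uniformContinuous_ρ (V : TypeOneRep t d) :
    UniformContinuous (fun x : Uq t d => toDisc (V.ρ x)) := by
  let b := Module.finBasis 𝕜 V.carrier
  rw [uniformContinuous_disc_iff]
  have h : ∀ i j, {p : Uq t d × Uq t d | b.coord i (V.ρ p.1 (b j)) = b.coord i (V.ρ p.2 (b j))}
      ∈ uniformity (Uq t d) := fun i j =>
    uniformContinuous_disc_iff.1 (uniformContinuous_matrixElement V (b.coord i) (b j))
  have h' := Filter.iInter_mem.2 fun i => Filter.iInter_mem.2 (h i)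
  refine Filter.mem_of_superset h' ?_
  intro p hp
  simp only [Set.mem_iInter, Set.mem_ofPred_eq] at hp
  exact b.ext fun j => b.ext_elem fun i => hp i j

variable (t d) in
lemma uniformContinuous_counit :
    UniformContinuous (fun x : Uq t d => toDisc (Uq.counit t d x)) := by
  have h := uniformContinuous_matrixElement (TypeOneRep.trivialRep t d)
    (LinearMap.id : 𝕜 →ₗ[𝕜] 𝕜) (1 : 𝕜)
  convert h using 3 with x
  exact (mul_one _).symm

variable (t d) in
lemma uniformContinuous_comul :
    UniformContinuous (fun x : Uq t d => Uq.comul t d x) := by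
  refine uniformContinuous_iInf_rng.2 fun V => uniformContinuous_iInf_rng.2 fun W =>
    uniformContinuous_iInf_rng.2 fun _ => uniformContinuous_iInf_rng.2 fun _ =>
    uniformContinuous_iInf_rng.2 fun f => uniformContinuous_iInf_rng.2 fun v =>
    uniformContinuous_comap' ?_
  exact uniformContinuous_matrixElement (V.tensor W) f v

variable (t d) in
lemma uniformContinuous_tmul :
    UniformContinuous₂ (fun x y : Uq t d => x ⊗ₜ[𝕜] y) := by
  refine uniformContinuous_iInf_rng.2 fun V => uniformContinuous_iInf_rng.2 fun W =>
    uniformContinuous_iInf_rng.2 fun _ => uniformContinuous_iInf_rng.2 fun _ =>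
    uniformContinuous_iInf_rng.2 fun f => uniformContinuous_iInf_rng.2 fun v =>
    uniformContinuous_comap' ?_
  have h1 := DiscreteUniformity.uniformContinuous
    (Disc (Module.End 𝕜 V.carrier) × Disc (Module.End 𝕜 W.carrier))
    (fun p => toDisc (f (TensorProduct.map (ofDisc p.1) (ofDisc p.2) v)))
  have h2 : UniformContinuous (fun p : Uq t d × Uq t d =>
      (toDisc (V.ρ p.1), toDisc (W.ρ p.2))) :=
    ((uniformContinuous_ρ V).comp uniformContinuous_fst).prodMk
      ((uniformContinuous_ρ W).comp uniformContinuous_snd)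
  exact h1.comp h2

/-- The action of the completion on a finite-dimensional representation of type 1, the extension
by continuity of the action of `U_q(sl₂)`. -/
def act (V : TypeOneRep t d) (σ : UqHat t d) : Module.End 𝕜 V.carrier :=
  ofDisc (UniformSpace.Completion.extension (fun x : Uq t d => toDisc (V.ρ x)) σ)

/-- The coproduct of the completion, the extension of `Δ` by continuity. -/
def comulHat : UqHat t d → UqTensorHat t d :=
  UniformSpace.Completion.map fun x : Uq t d => Uq.comul t d x

/-- The counit of the completion, the extension of `ε` by continuity. -/
def counitHat (σ : UqHat t d) : 𝕜 :=
  ofDisc (UniformSpace.Completion.extension (fun x : Uq t d => toDisc (Uq.counit t d x)) σ)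

/-- The element `σ ⊗ τ`, the extension of `(x, y) ↦ x ⊗ y` by continuity. -/
def tmulHat : UqHat t d → UqHat t d → UqTensorHat t d :=
  UniformSpace.Completion.map₂ fun x y : Uq t d => x ⊗ₜ[𝕜] y

/-- Grouplike elements of the completion. -/
def IsGrouplike (σ : UqHat t d) : Prop :=
  counitHat σ = 1 ∧ comulHat σ = tmulHat σ σ

end Completion

/-! ## The elements `K_a` -/

section Ka

variable {t : 𝕜ˣ} {d : ℕ}

lemma act_coe (V : TypeOneRep t d) (x : Uq t d) : act V (x : UqHat t d) = V.ρ x :=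
  UniformSpace.Completion.extension_coe (uniformContinuous_ρ V) x

lemma continuous_act (V : TypeOneRep t d) :
    Continuous (fun σ : UqHat t d => toDisc (act V σ)) :=
  UniformSpace.Completion.continuous_extension

/-- An element of the completion is determined by its action on the representations of type 1. -/
lemma ext_act {σ τ : UqHat t d} (h : ∀ V : TypeOneRep t d, act V σ = act V τ) : σ = τ := by
  let ι := Σ V : TypeOneRep t d, Module.Dual 𝕜 V.carrier × V.carrier
  let Φ : Uq t d → (ι → Disc 𝕜) := fun x i => toDisc (i.2.1 (i.1.ρ x i.2.2))
  let Ψ : UqHat t d → (ι → Disc 𝕜) := fun x i => toDisc (i.2.1 (act i.1 x i.2.2))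
  have hΦ : IsUniformInducing Φ := by
    rw [isUniformInducing_iff_uniformSpace]
    rw [Pi.uniformSpace_eq, UniformSpace.comap_iInf]
    simp only [← UniformSpace.comap_comap]
    apply le_antisymm
    · refine le_iInf fun V => le_iInf fun f => le_iInf fun v => ?_
      exact iInf_le (fun i : ι => UniformSpace.comap ((fun g : ι → Disc 𝕜 => g i) ∘ Φ)
        inferInstance) ⟨V, f, v⟩
    · refine le_iInf fun i => ?_
      exact (iInf_le _ i.1).trans ((iInf_le _ i.2.1).trans (iInf_le _ i.2.2))
  have hinj := (UniformSpace.Completion.isUniformInducing_extension hΦ).injective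
  have hc : Continuous Ψ := by
    refine continuous_pi fun i => ?_
    exact (continuous_of_discreteTopology
      (f := fun g : Disc (Module.End 𝕜 i.1.carrier) => toDisc (i.2.1 (ofDisc g i.2.2)))).comp
      (continuous_act i.1)
  have hΨ : UniformSpace.Completion.extension Φ = Ψ := by
    refine UniformSpace.Completion.ext UniformSpace.Completion.continuous_extension hc fun x => ?_
    rw [UniformSpace.Completion.extension_coe hΦ.uniformContinuous]
    funext i
    simp only [Φ, Ψ, act_coe]
  apply hinj
  rw [hΨ]
  funext i
  simp only [Ψ, h]

/-- A representation of type 1 has only finitely many weights. -/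
lemma exists_weight_bound (ht : ∀ n : ℤ, (t : 𝕜) ^ n = 1 → n = 0) (V : TypeOneRep t d) :
    ∃ N : ℕ, ∀ n : ℤ, V.weightSpace n ≠ ⊥ → n ∈ Finset.Icc (-(N : ℤ)) N := by
  have hinj : Function.Injective (fun n : ℤ => (t : 𝕜) ^ n) := by
    intro m n hmn
    have : (t : 𝕜) ^ (m - n) = 1 := by
      rw [zpow_sub₀ t.ne_zero]
      exact (div_eq_one_iff_eq (zpow_ne_zero _ t.ne_zero)).2 hmn
    have := ht _ this
    omega
  have hfin : {n : ℤ | V.weightSpace n ≠ ⊥}.Finite :=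
    ((Module.End.finite_hasEigenvalue (V.ρ (Uq.L t d))).preimage hinj.injOn).subset
      fun n hn => hn
  refine ⟨hfin.toFinset.sup Int.natAbs, fun n hn => ?_⟩
  have := Finset.le_sup (f := Int.natAbs) (hfin.mem_toFinset.2 hn)
  rw [Finset.mem_Icc]
  omega

/-- For `t` not a root of unity and `a ≠ 0`, there is exactly one element of the completion that
acts on every vector of weight `n` by `a ^ n`. -/
lemma existsUnique_act (ht : ∀ n : ℤ, (t : 𝕜) ^ n = 1 → n = 0) (d : ℕ) (a : 𝕜ˣ) :
    ∃! κ : UqHat t d, ∀ (V : TypeOneRep t d) (n : ℤ), ∀ v ∈ V.weightSpace n,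
      act V κ v = (a : 𝕜) ^ n • v := by
  have hext : ∀ (V : TypeOneRep t d) (g h : Module.End 𝕜 V.carrier),
      (∀ n : ℤ, ∀ v ∈ V.weightSpace n, g v = h v) → g = h := by
    intro V g h hgh
    have : (⊤ : Submodule 𝕜 V.carrier) ≤ LinearMap.eqLocus g h := by
      rw [← V.iSup_weight]
      exact iSup_le fun n v hv => hgh n v hv
    exact LinearMap.ext fun v => this (Submodule.mem_top (x := v))
  refine existsUnique_of_exists_of_unique ?_ ?_
  · have hinj : Function.Injective (fun n : ℤ => (t : 𝕜) ^ n) := by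
      intro m n hmn
      have : (t : 𝕜) ^ (m - n) = 1 := by
        rw [zpow_sub₀ t.ne_zero]
        exact (div_eq_one_iff_eq (zpow_ne_zero _ t.ne_zero)).2 hmn
      have := ht _ this
      omega
    let p : ℕ → Polynomial 𝕜 := fun N =>
      Lagrange.interpolate (Finset.Icc (-(N : ℤ)) N) (fun n : ℤ => (t : 𝕜) ^ n)
        (fun n : ℤ => (a : 𝕜) ^ n)
    let x : ℕ → Uq t d := fun N => Polynomial.aeval (Uq.L t d) (p N)
    have hx : ∀ (V : TypeOneRep t d) (N : ℕ) (n : ℤ), n ∈ Finset.Icc (-(N : ℤ)) N →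
        ∀ v ∈ V.weightSpace n, V.ρ (x N) v = (a : 𝕜) ^ n • v := by
      intro V N n hn v hv
      by_cases hv0 : v = 0
      · simp [hv0]
      · have := Module.End.aeval_apply_of_hasEigenvector (p := p N) (x := v)
          (f := V.ρ (Uq.L t d)) (μ := (t : 𝕜) ^ n) ⟨hv, hv0⟩
        rw [Polynomial.aeval_algHom_apply] at this
        rw [this]
        congr 1
        exact Lagrange.eval_interpolate_at_node _ hinj.injOn hn
    have hxV : ∀ V : TypeOneRep t d, ∃ N : ℕ, ∀ M ≥ N, ∀ (n : ℤ), ∀ v ∈ V.weightSpace n,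
        V.ρ (x M) v = (a : 𝕜) ^ n • v := by
      intro V
      obtain ⟨N, hN⟩ := exists_weight_bound ht V
      refine ⟨N, fun M hM n v hv => ?_⟩
      by_cases hb : V.weightSpace n = ⊥
      · rw [hb, Submodule.mem_bot] at hv
        simp [hv]
      · refine hx V M n ?_ v hv
        have := hN n hb
        rw [Finset.mem_Icc] at this ⊢
        omega
    have hconst : ∀ V : TypeOneRep t d, ∃ N : ℕ, ∀ M ≥ N, V.ρ (x M) = V.ρ (x N) := by
      intro V
      obtain ⟨N, hN⟩ := hxV V
      exact ⟨N, fun M hM => hext V _ _ fun n v hv => by rw [hN M hM n v hv, hN N le_rfl n v hv]⟩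
    have hcau : CauchySeq x := by
      refine cauchy_iInf_uniformSpace'.2 fun V => cauchy_iInf_uniformSpace'.2 fun f =>
        cauchy_iInf_uniformSpace'.2 fun v => cauchy_comap_uniformSpace.2 ?_
      obtain ⟨N, hN⟩ := hconst V
      have : Filter.Tendsto (fun M => toDisc (f (V.ρ (x M) v))) Filter.atTop
          (nhds (toDisc (f (V.ρ (x N) v)))) := by
        refine tendsto_const_nhds.congr' ?_
        filter_upwards [Filter.eventually_ge_atTop N] with M hM
        rw [hN M hM]
      rw [Filter.map_map]
      exact this.cauchySeq
    obtain ⟨κ, hκ⟩ := cauchySeq_tendsto_of_complete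
      (u := fun N => (x N : UqHat t d))
      ((UniformSpace.Completion.uniformContinuous_coe (Uq t d)).comp_cauchySeq hcau)
    refine ⟨κ, fun V n v hv => ?_⟩
    obtain ⟨N, hN⟩ := hxV V
    have h1 := ((continuous_act V).tendsto κ).comp hκ
    have h2 : ∀ᶠ M in Filter.atTop, toDisc (act V (x M : UqHat t d)) = toDisc (act V κ) := by
      have := h1 (mem_nhds_discrete.2 rfl : {toDisc (act V κ)} ∈ nhds (toDisc (act V κ)))
      exact this
    obtain ⟨M, hM1, hM2⟩ := (h2.and (Filter.eventually_ge_atTop N)).exists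
    have h3 : act V (x M : UqHat t d) = act V κ := hM1
    rw [← h3, act_coe, hN M hM2 n v hv]
  · intro κ κ' h h'
    exact ext_act fun V => hext V _ _ fun n v hv => by rw [h V n v hv, h' V n v hv]

/-- `K_a`, the element of the completion that acts on every vector of weight `n` by `a ^ n`. -/
def Ka (ht : ∀ n : ℤ, (t : 𝕜) ^ n = 1 → n = 0) (d : ℕ) (a : 𝕜ˣ) : UqHat t d :=
  (existsUnique_act ht d a).choose

lemma act_Ka (ht : ∀ n : ℤ, (t : 𝕜) ^ n = 1 → n = 0) (d : ℕ) (a : 𝕜ˣ) (V : TypeOneRep t d)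
    (n : ℤ) (v : V.carrier) (hv : v ∈ V.weightSpace n) :
    act V (Ka ht d a) v = (a : 𝕜) ^ n • v :=
  (existsUnique_act ht d a).choose_spec.1 V n v hv

end Ka

/-! ## The ground field -/

/-- The element `s ^ m` of the field `ℂ(s)` of rational functions, as a unit. -/
def tPow (m : ℕ) : (RatFunc ℂ)ˣ := Units.mk0 RatFunc.X RatFunc.X_ne_zero ^ m

lemma tPow_zpow_eq_one {m : ℕ} (hm : 0 < m) (n : ℤ) (h : (tPow m : RatFunc ℂ) ^ n = 1) :
    n = 0 := by
  have key : ∀ k : ℕ, (RatFunc.X : RatFunc ℂ) ^ k = 1 → k = 0 := by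
    intro k hk
    have h1 : algebraMap (Polynomial ℂ) (RatFunc ℂ) (Polynomial.X ^ k)
        = algebraMap (Polynomial ℂ) (RatFunc ℂ) 1 := by
      rw [map_pow, RatFunc.algebraMap_X, hk, map_one]
    have h2 := congrArg Polynomial.natDegree (RatFunc.algebraMap_injective ℂ h1)
    simpa using h2
  have h' : ((RatFunc.X : RatFunc ℂ) ^ m) ^ n = 1 := by simpa [tPow] using h
  have h3 : (RatFunc.X : RatFunc ℂ) ^ (m * n.natAbs) = 1 := by
    rw [pow_mul]
    obtain hn | hn := Int.natAbs_eq n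
    · rw [hn, zpow_natCast] at h'
      exact h'
    · rw [hn, zpow_neg, zpow_natCast, inv_eq_one] at h'
      exact h'
  have := key _ h3
  have hn : n.natAbs = 0 := by
    rcases Nat.mul_eq_zero.1 this with h | h
    · omega
    · exact h
  omega

end QuantumSL2

end

open scoped TensorProduct

noncomputable section

/-! Write `V_n` for the irreducible representation of highest weight `n`, with basis `v_0, …, v_n`.
The condition `Δσ = σ ⊗ σ` says that `σ` acts on a tensor product of irreducibles as the tensor
product of its actions (`IsGrouplike.act_tensor`), and `ε(σ) = 1` says that `σ` fixes invariant
vectors (`act_invariant`).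

Both facts are applied to `V_1 ⊗ V_1`, which contains the invariant vector `v_0 ⊗ v_1 - q⁻¹ v_1 ⊗
v_0`. If `A` is the matrix of `σ` on `V_1`, then `A ⊗ A` fixes this vector. Because `q² ≠ 1`,
comparing coefficients forces `A` to be diagonal of determinant `1`
(`diagonal_of_fixes_antisymmetric`). So `A = diag(a, a⁻¹)`, which is the action of `K_a`.

The element `K_a` also acts multiplicatively on tensor products (`act_tensor_Ka`), and `V_{n+1}`
embeds in `V_1 ⊗ V_n`. By induction on `n`, `σ` and `K_a` agree on every `V_n`
(`act_simpleRep_succ`).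

It remains to see that the `V_n` detect elements of the completion (`ext_act_simpleRep`). Complete
reducibility is not proved as such. It is enough that every type 1 representation is generated by
its highest weight vectors (`IsQuantumTriple.mem_of_stable`), each nonzero one being the image of
`v_0` under an intertwiner from some `V_n` (`simpleRep.exists_intertwiner`). -/

namespace QuantumSL2

/-! ### Quantum integers -/

section QInt

variable {𝕜 : Type} [Field 𝕜] {q : 𝕜}

/-- The quantum integer `[n] = (q ^ n - q ^ (-n)) / (q - q⁻¹)`. -/
def qInt (q : 𝕜) (n : ℤ) : 𝕜 := (q - q⁻¹)⁻¹ * (q ^ n - (q ^ n)⁻¹)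

@[simp] lemma qInt_zero : qInt q 0 = 0 := by simp [qInt]

lemma qInt_neg (n : ℤ) : qInt q (-n) = -qInt q n := by
  simp only [qInt, zpow_neg, inv_inv]
  ring

lemma qInt_ne_zero (hq0 : q ≠ 0) (hq : ∀ n : ℤ, q ^ n = 1 → n = 0) {n : ℤ} (hn : n ≠ 0) :
    qInt q n ≠ 0 := by
  have key : ∀ n : ℤ, n ≠ 0 → q ^ n - (q ^ n)⁻¹ ≠ 0 := by
    intro n hn h
    have h1 : q ^ (n + n) = 1 := by
      rw [zpow_add₀ hq0]
      nth_rewrite 2 [sub_eq_zero.1 h]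
      exact mul_inv_cancel₀ (zpow_ne_zero _ hq0)
    have := hq _ h1
    omega
  have h1 := key 1 one_ne_zero
  rw [zpow_one] at h1
  exact mul_ne_zero (inv_ne_zero h1) (key n hn)

/-- This is the recursion behind all string computations: moving `e` past one more `f` adds `[n -
2j]` to the coefficient `[j][n - j + 1]`. -/
lemma qInt_mul_add (hq0 : q ≠ 0) (hq : ∀ n : ℤ, q ^ n = 1 → n = 0) (j n : ℤ) :
    qInt q j * qInt q (n - j + 1) + qInt q (n - 2 * j) = qInt q (j + 1) * qInt q (n - j) := by
  have h1 := qInt_ne_zero hq0 hq one_ne_zero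
  have h2 : q ^ 2 - 1 ≠ 0 := by
    intro h
    have := hq 2 (by exact_mod_cast sub_eq_zero.1 h)
    omega
  have hj := zpow_ne_zero j hq0
  have hn := zpow_ne_zero n hq0
  have h3 : q - q⁻¹ ≠ 0 := by
    intro h
    simp [qInt, h] at h1
  simp only [qInt, two_mul, zpow_sub₀ hq0, zpow_add₀ hq0, zpow_one]
  field_simp
  ring

end QInt

/-! ### Highest weight theory for `e` and `f` -/

/-- Operators `e`, `f` on a space with finitely many nonzero weight spaces `W n`, which shift the
weight by `2` and `-2` and whose commutator is `[n]` on `W n`. -/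
structure IsQuantumTriple {𝕜 M : Type} [Field 𝕜] [AddCommGroup M] [Module 𝕜 M] (q : 𝕜)
    (W : ℤ → Submodule 𝕜 M) (e f : Module.End 𝕜 M) : Prop where
  raise : ∀ {n : ℤ} {v : M}, v ∈ W n → e v ∈ W (n + 2)
  lower : ∀ {n : ℤ} {v : M}, v ∈ W n → f v ∈ W (n - 2)
  comm : ∀ {n : ℤ} {v : M}, v ∈ W n → e (f v) = f (e v) + qInt q n • v
  bound : ∃ N : ℕ, ∀ n : ℤ, N < n.natAbs → W n = ⊥
  ne_zero : q ≠ 0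
  not_root : ∀ n : ℤ, q ^ n = 1 → n = 0

namespace IsQuantumTriple

variable {𝕜 M : Type} [Field 𝕜] [AddCommGroup M] [Module 𝕜 M] {q : 𝕜}
  {W : ℤ → Submodule 𝕜 M} {e f : Module.End 𝕜 M}

/-- The relations survive because `[-n] = -[n]`. This turns statements about highest weight vectors
into statements about lowest weight vectors. -/
lemma symm (h : IsQuantumTriple q W e f) : IsQuantumTriple q (fun n => W (-n)) f e where
  raise {n v} hv := by
    have := h.lower hv
    rwa [show -n - 2 = -(n + 2) by ring] at this
  lower {n v} hv := by
    have := h.raise hv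
    rwa [show -n + 2 = -(n - 2) by ring] at this
  comm {n v} hv := by
    rw [h.comm hv, qInt_neg]
    simp
  bound := by
    obtain ⟨N, hN⟩ := h.bound
    exact ⟨N, fun n hn => hN _ (by rwa [Int.natAbs_neg])⟩
  ne_zero := h.ne_zero
  not_root := h.not_root

lemma pow_e_mem (h : IsQuantumTriple q W e f) {n : ℤ} {v : M} (hv : v ∈ W n) (k : ℕ) :
    (e ^ k) v ∈ W (n + 2 * k) := by
  induction k with
  | zero => simpa using hv
  | succ k ih =>
    rw [pow_succ', Module.End.mul_apply]
    have := h.raise ih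
    rwa [show n + 2 * (k : ℤ) + 2 = n + 2 * ((k + 1 : ℕ) : ℤ) by push_cast; ring] at this

lemma pow_f_mem (h : IsQuantumTriple q W e f) {n : ℤ} {v : M} (hv : v ∈ W n) (k : ℕ) :
    (f ^ k) v ∈ W (n - 2 * k) := by
  have := h.symm.pow_e_mem (n := -n) (v := v) (by simpa using hv) k
  rwa [show -(-n + 2 * (k : ℤ)) = n - 2 * k by ring] at this

lemma exists_pow_e_eq_zero (h : IsQuantumTriple q W e f) {n : ℤ} {v : M} (hv : v ∈ W n) :
    ∃ k : ℕ, (e ^ k) v = 0 := by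
  obtain ⟨N, hN⟩ := h.bound
  -- For this exponent `k`, the weight `n + 2k` exceeds the bound `N`.
  refine ⟨N + n.natAbs + 1, ?_⟩
  have := h.pow_e_mem hv (N + n.natAbs + 1)
  rw [hN _ (by omega)] at this
  simpa using this

/-- The action of `e` on the string of a highest weight vector. -/
lemma e_pow_f (h : IsQuantumTriple q W e f) {n : ℤ} {w : M} (hw : w ∈ W n) (hew : e w = 0)
    (j : ℕ) : e ((f ^ (j + 1)) w) = (qInt q (j + 1) * qInt q (n - j)) • (f ^ j) w := by
  induction j with
  | zero =>
    have := qInt_mul_add h.ne_zero h.not_root 0 n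
    simp only [qInt_zero, zero_mul, zero_add, mul_zero, sub_zero] at this
    simp [h.comm hw, hew, ← this]
  | succ j ih =>
    rw [pow_succ', Module.End.mul_apply, h.comm (h.pow_f_mem hw (j + 1)), ih, map_smul,
      ← Module.End.mul_apply, ← pow_succ', ← add_smul]
    congr 1
    have := qInt_mul_add h.ne_zero h.not_root (j + 1) n
    push_cast
    rw [← this]
    congr 2
    ring_nf

/-- The weight of a highest weight vector is a natural number, which determines the length of its
string. -/
lemma exists_nat_weight (h : IsQuantumTriple q W e f) {n : ℤ} {w : M} (hw : w ∈ W n)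
    (hew : e w = 0) (hw0 : w ≠ 0) : ∃ m : ℕ, n = m ∧ (f ^ (m + 1)) w = 0 := by
  classical
  have hk : ∃ k : ℕ, (f ^ k) w = 0 :=
    h.symm.exists_pow_e_eq_zero (n := -n) (v := w) (by simpa using hw)
  obtain ⟨k, hk'⟩ : ∃ k, Nat.find hk = k + 1 :=
    Nat.exists_eq_succ_of_ne_zero fun h0 => hw0 (by simpa using (Nat.find_eq_zero hk).1 h0)
  have h1 : (f ^ (k + 1)) w = 0 := hk' ▸ Nat.find_spec hk
  have h2 : (f ^ k) w ≠ 0 := Nat.find_min hk (by omega)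
  -- With `k + 1` the least exponent killing `w`, applying `e` to `f ^ (k + 1) w = 0` gives `[k +
  -- 1][n - k] = 0`, hence `n = k`.
  have h3 := h.e_pow_f hw hew k
  rw [h1, map_zero, eq_comm, smul_eq_zero, or_iff_left h2, mul_eq_zero] at h3
  have h4 : n - k = 0 := by
    by_contra hc
    rcases h3 with h3 | h3
    · exact qInt_ne_zero h.ne_zero h.not_root (by omega) h3
    · exact qInt_ne_zero h.ne_zero h.not_root hc h3
  exact ⟨k, by omega, h1⟩

/-- The constant is the product of `[j + 1][n - j]` over `j < k`; the bound `k ≤ n` keeps every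
factor nonzero. -/
lemma pow_e_pow_f (h : IsQuantumTriple q W e f) {n : ℤ} {w : M} (hw : w ∈ W n)
    (hew : e w = 0) (k : ℕ) (hk : (k : ℤ) ≤ n) : ∃ c : 𝕜, c ≠ 0 ∧ (e ^ k) ((f ^ k) w) = c • w := by
  induction k with
  | zero => exact ⟨1, one_ne_zero, by simp⟩
  | succ k ih =>
    obtain ⟨c, hc, h1⟩ := ih (by omega)
    refine ⟨qInt q (k + 1) * qInt q (n - k) * c, mul_ne_zero (mul_ne_zero ?_ ?_) hc, ?_⟩
    · exact qInt_ne_zero h.ne_zero h.not_root (by omega)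
    · exact qInt_ne_zero h.ne_zero h.not_root (by omega)
    · rw [pow_succ, Module.End.mul_apply, h.e_pow_f hw hew, map_smul, h1, smul_smul]

/-- Induction on the power of `e` that kills `v`: subtracting a suitable multiple of `f ^ k (e ^ k
v)`, which lies in `S`, lowers this power by one. -/
lemma mem_of_nonneg (h : IsQuantumTriple q W e f) {S : Submodule 𝕜 M}
    (hf : ∀ v ∈ S, f v ∈ S) (hS : ∀ (n : ℤ) (w : M), w ∈ W n → e w = 0 → w ∈ S)
    {n : ℤ} (hn : 0 ≤ n) {v : M} (hv : v ∈ W n) : v ∈ S := by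
  have hfk : ∀ (k : ℕ), ∀ v ∈ S, (f ^ k) v ∈ S := by
    intro k
    induction k with
    | zero => simp
    | succ k ih => intro v hv; rw [pow_succ, Module.End.mul_apply]; exact ih _ (hf _ hv)
  obtain ⟨k, hk⟩ := h.exists_pow_e_eq_zero hv
  induction k generalizing v with
  | zero => simp only [pow_zero, Module.End.one_apply] at hk; simp [hk]
  | succ k ih =>
    have hw := h.pow_e_mem hv k
    have hew : e ((e ^ k) v) = 0 := by rwa [pow_succ', Module.End.mul_apply] at hk
    -- The vector `e ^ k v` has weight `n + 2k ≥ k`; this is where `0 ≤ n` is needed.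
    obtain ⟨c, hc, h1⟩ := h.pow_e_pow_f hw hew k (by omega)
    have h2 := h.pow_f_mem hw k
    rw [show n + 2 * (k : ℤ) - 2 * k = n by ring] at h2
    have h3 := ih (sub_mem hv ((W n).smul_mem c⁻¹ h2)) (by
      rw [map_sub, map_smul, h1, smul_smul, inv_mul_cancel₀ hc, one_smul, sub_self])
    have h4 := S.add_mem h3 (S.smul_mem c⁻¹ (hfk k _ (hS _ _ hw hew)))
    rwa [sub_add_cancel] at h4

/-- A stable subspace that contains the highest weight vectors contains all weight vectors. -/
lemma mem_of_stable (h : IsQuantumTriple q W e f) {S : Submodule 𝕜 M}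
    (he : ∀ v ∈ S, e v ∈ S) (hf : ∀ v ∈ S, f v ∈ S)
    (hS : ∀ (n : ℤ) (w : M), w ∈ W n → e w = 0 → w ∈ S) {n : ℤ} {v : M} (hv : v ∈ W n) :
    v ∈ S := by
  rcases le_total 0 n with hn | hn
  · exact h.mem_of_nonneg hf hS hn hv
  -- For negative weights the roles of `e` and `f` are exchanged, so lowest weight vectors must lie
  -- in `S`. Such a vector `u` has weight `-m`, the vector `e ^ m u` has weight `m ≥ 0` and is
  -- already in `S`, and `f ^ m` brings it back to a nonzero multiple of `u`.
  refine h.symm.mem_of_nonneg (n := -n) he ?_ (by omega) (by simpa using hv)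
  intro k u hu hfu
  by_cases hu0 : u = 0
  · simp [hu0]
  obtain ⟨m, rfl, hm⟩ := h.symm.exists_nat_weight hu hfu hu0
  obtain ⟨c, hc, h1⟩ := h.symm.pow_e_pow_f hu hfu m le_rfl
  have hw := h.pow_e_mem hu m
  rw [pow_succ', Module.End.mul_apply] at hm
  have h2 := h.mem_of_nonneg hf hS (by omega) hw
  have hfk : ∀ (k : ℕ), (f ^ k) ((e ^ m) u) ∈ S := by
    intro k
    induction k with
    | zero => simpa using h2
    | succ k ih => rw [pow_succ', Module.End.mul_apply]; exact hf _ ih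
  have h3 := S.smul_mem c⁻¹ (hfk m)
  rwa [h1, smul_smul, inv_mul_cancel₀ hc, one_smul] at h3

end IsQuantumTriple

variable {𝕜 : Type} [Field 𝕜] {t : 𝕜ˣ} {d : ℕ}

/-! ## Actions of the completions -/

lemma continuous_toDisc_map₂ {X A B C : Type} [TopologicalSpace X] (F : A → B → C) {f : X → A}
    {g : X → B} (hf : Continuous fun x => toDisc (f x)) (hg : Continuous fun x => toDisc (g x)) :
    Continuous fun x => toDisc (F (f x) (g x)) := by
  have h : Continuous (fun p : Disc A × Disc B => toDisc (F (ofDisc p.1) (ofDisc p.2))) :=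
    (DiscreteUniformity.uniformContinuous _ _).continuous
  exact h.comp (hf.prodMk hg)

/-- The operators carry the discrete topology, so agreeing with `σ` on `V` and `W` is an open
condition, and the dense image of `U_q(sl₂)` meets it. -/
lemma exists_act_eq (V W : TypeOneRep t d) (σ : UqHat t d) :
    ∃ x : Uq t d, act V σ = V.ρ x ∧ act W σ = W.ρ x := by
  have hV : IsOpen {τ : UqHat t d | toDisc (act V τ) = toDisc (act V σ)} :=
    (isOpen_discrete {toDisc (act V σ)}).preimage (continuous_act V)
  have hW : IsOpen {τ : UqHat t d | toDisc (act W τ) = toDisc (act W σ)} :=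
    (isOpen_discrete {toDisc (act W σ)}).preimage (continuous_act W)
  obtain ⟨x, hxV, hxW⟩ := UniformSpace.Completion.denseRange_coe.exists_mem_open
    (hV.inter hW) ⟨σ, rfl, rfl⟩
  refine ⟨x, ?_, ?_⟩
  · rw [← act_coe]
    exact hxV.symm
  · rw [← act_coe]
    exact hxW.symm

lemma act_intertwine {V W : TypeOneRep t d} (φ : V.carrier →ₗ[𝕜] W.carrier)
    (hφ : ∀ x v, φ (V.ρ x v) = W.ρ x (φ v)) (σ : UqHat t d) (v : V.carrier) :
    φ (act V σ v) = act W σ (φ v) := by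
  obtain ⟨x, hV, hW⟩ := exists_act_eq V W σ
  rw [hV, hW, hφ]

lemma act_trivialRep (σ : UqHat t d) (c : 𝕜) :
    act (TypeOneRep.trivialRep t d) σ c = counitHat σ * c := by
  have h : ∀ τ : UqHat t d, toDisc (act (TypeOneRep.trivialRep t d) τ) =
      toDisc (Algebra.lmul 𝕜 𝕜 (counitHat τ)) := by
    intro τ
    induction τ using UniformSpace.Completion.induction_on with
    | hp =>
      refine isClosed_eq (continuous_act _) ?_
      exact (continuous_of_discreteTopology
        (f := fun c : Disc 𝕜 => toDisc (Algebra.lmul 𝕜 𝕜 (ofDisc c)))).comp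
        UniformSpace.Completion.continuous_extension
    | ih x =>
      rw [act_coe, counitHat, UniformSpace.Completion.extension_coe (uniformContinuous_counit t d)]
      rfl
  exact LinearMap.congr_fun (h σ) c

lemma uniformContinuous_tensor_matrixElement {V W : TypeOneRep t d} (hV : V.IsIrreducible)
    (hW : W.IsIrreducible) (f : Module.Dual 𝕜 (V.carrier ⊗[𝕜] W.carrier))
    (v : V.carrier ⊗[𝕜] W.carrier) :
    UniformContinuous (fun x : Uq t d ⊗[𝕜] Uq t d => toDisc (f (V.tensorρ W x v))) :=
  uniformContinuous_iInf_dom (i := V) <| uniformContinuous_iInf_dom (i := W) <|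
    uniformContinuous_iInf_dom (i := hV) <| uniformContinuous_iInf_dom (i := hW) <|
    uniformContinuous_iInf_dom (i := f) <| uniformContinuous_iInf_dom (i := v)
    uniformContinuous_comap

/-- Finitely many matrix elements determine an operator on `V ⊗ W`. Irreducibility enters because
only matrix elements of tensor products of irreducibles define the uniformity. -/
lemma uniformContinuous_tensorρ {V W : TypeOneRep t d} (hV : V.IsIrreducible)
    (hW : W.IsIrreducible) :
    UniformContinuous (fun x : Uq t d ⊗[𝕜] Uq t d => toDisc (V.tensorρ W x)) := by
  let b := Module.finBasis 𝕜 (V.carrier ⊗[𝕜] W.carrier)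
  rw [uniformContinuous_disc_iff]
  have h : ∀ i j, {p : (Uq t d ⊗[𝕜] Uq t d) × (Uq t d ⊗[𝕜] Uq t d) |
      b.coord i (V.tensorρ W p.1 (b j)) = b.coord i (V.tensorρ W p.2 (b j))}
      ∈ uniformity (Uq t d ⊗[𝕜] Uq t d) := fun i j =>
    uniformContinuous_disc_iff.1 (uniformContinuous_tensor_matrixElement hV hW (b.coord i) (b j))
  have h' := Filter.iInter_mem.2 fun i => Filter.iInter_mem.2 (h i)
  refine Filter.mem_of_superset h' ?_
  intro p hp
  simp only [Set.mem_iInter, Set.mem_ofPred_eq] at hp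
  exact b.ext fun j => b.ext_elem fun i => hp i j

/-- The action of the completed tensor square on `V ⊗ W`. -/
def actTensor (V W : TypeOneRep t d) (σ : UqTensorHat t d) :
    Module.End 𝕜 (V.carrier ⊗[𝕜] W.carrier) :=
  ofDisc (UniformSpace.Completion.extension
    (fun x : Uq t d ⊗[𝕜] Uq t d => toDisc (V.tensorρ W x)) σ)

lemma continuous_actTensor (V W : TypeOneRep t d) :
    Continuous (fun σ : UqTensorHat t d => toDisc (actTensor V W σ)) :=
  UniformSpace.Completion.continuous_extension

lemma actTensor_coe {V W : TypeOneRep t d} (hV : V.IsIrreducible) (hW : W.IsIrreducible)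
    (x : Uq t d ⊗[𝕜] Uq t d) : actTensor V W (x : UqTensorHat t d) = V.tensorρ W x :=
  UniformSpace.Completion.extension_coe (uniformContinuous_tensorρ hV hW) x

/-- Both sides are continuous in `σ`, and on the dense image of `U_q(sl₂)` they agree by the
definition of the action on `V ⊗ W`. -/
lemma actTensor_comulHat {V W : TypeOneRep t d} (hV : V.IsIrreducible) (hW : W.IsIrreducible)
    (σ : UqHat t d) : actTensor V W (comulHat σ) = act (V.tensor W) σ := by
  have h : ∀ τ : UqHat t d, toDisc (actTensor V W (comulHat τ)) =
      (toDisc (act (V.tensor W) τ) : Disc (Module.End 𝕜 (V.carrier ⊗[𝕜] W.carrier))) := by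
    intro τ
    induction τ using UniformSpace.Completion.induction_on with
    | hp =>
      exact isClosed_eq ((continuous_actTensor V W).comp UniformSpace.Completion.continuous_map)
        (continuous_act (V.tensor W))
    | ih x =>
      have h1 : comulHat (x : UqHat t d) = (Uq.comul t d x : UqTensorHat t d) :=
        UniformSpace.Completion.map_coe (uniformContinuous_comul t d) x
      have h2 := actTensor_coe hV hW (Uq.comul t d x)
      rw [← h1] at h2
      exact h2.trans (act_coe (V.tensor W) x).symm
  exact h σ

lemma actTensor_tmulHat {V W : TypeOneRep t d} (hV : V.IsIrreducible) (hW : W.IsIrreducible)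
    (σ τ : UqHat t d) :
    actTensor V W (tmulHat σ τ) = TensorProduct.map (act V σ) (act W τ) := by
  have h1 : Continuous (fun p : UqHat t d × UqHat t d => tmulHat p.1 p.2) :=
    UniformSpace.Completion.continuous_map₂ continuous_fst continuous_snd
  have h2 : Continuous (fun p : UqHat t d × UqHat t d =>
      toDisc (actTensor V W (tmulHat p.1 p.2))) := (continuous_actTensor V W).comp h1
  have h3 := continuous_toDisc_map₂ (fun g h => TensorProduct.map g h)
    ((continuous_act V).comp (continuous_fst (X := UqHat t d) (Y := UqHat t d)))
    ((continuous_act W).comp (continuous_snd (X := UqHat t d) (Y := UqHat t d)))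
  have h4 := isClosed_eq h2 h3
  have h : ∀ σ τ : UqHat t d, toDisc (actTensor V W (tmulHat σ τ)) =
      toDisc (TensorProduct.map (act V σ) (act W τ)) := by
    intro σ τ
    refine UniformSpace.Completion.induction_on₂ (p := fun σ τ : UqHat t d =>
      toDisc (actTensor V W (tmulHat σ τ)) = toDisc (TensorProduct.map (act V σ) (act W τ)))
      σ τ h4 fun x y => ?_
    have h1 : tmulHat (x : UqHat t d) (y : UqHat t d) =
        ((x ⊗ₜ[𝕜] y : Uq t d ⊗[𝕜] Uq t d) : UqTensorHat t d) :=
      UniformSpace.Completion.map₂_coe_coe _ _ _ (uniformContinuous_tmul t d)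
    rw [h1, act_coe, act_coe, actTensor_coe hV hW, TypeOneRep.tensorρ_tmul]
  exact h σ τ

/-- This is the form in which `Δσ = σ ⊗ σ` is used. -/
lemma IsGrouplike.act_tensor {σ : UqHat t d} (hσ : IsGrouplike σ) {V W : TypeOneRep t d}
    (hV : V.IsIrreducible) (hW : W.IsIrreducible) :
    act (V.tensor W) σ = TensorProduct.map (act V σ) (act W σ) :=
  (actTensor_comulHat hV hW σ).symm.trans
    ((congrArg (actTensor V W) hσ.2).trans (actTensor_tmulHat hV hW σ σ))

/-! ## Intertwiners and highest weight vectors -/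

namespace Uq

lemma subalgebra_eq_top (S : Subalgebra 𝕜 (Uq t d)) (h : ∀ g, gen t d g ∈ S) (x : Uq t d) :
    x ∈ S := by
  obtain ⟨y, rfl⟩ := RingQuot.mkAlgHom_surjective 𝕜 (Rel t d) x
  change y ∈ S.comap (RingQuot.mkAlgHom 𝕜 (Rel t d))
  induction y using FreeAlgebra.induction with
  | grade0 r => exact Subalgebra.algebraMap_mem _ r
  | grade1 g => exact h g
  | mul a b ha hb => exact mul_mem ha hb
  | add a b ha hb => exact add_mem ha hb

end Uq

lemma end_pow_apply {M : Type} [AddCommGroup M] [Module 𝕜 M] {x : Module.End 𝕜 M} {c : 𝕜}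
    {v : M} (h : x v = c • v) (k : ℕ) : (x ^ k) v = c ^ k • v := by
  induction k with
  | zero => simp
  | succ k ih => rw [pow_succ, Module.End.mul_apply, h, map_smul, ih, smul_smul, pow_succ']

namespace TypeOneRep

lemma ρ_Linv_L (V : TypeOneRep t d) (v : V.carrier) :
    V.ρ (Uq.Linv t d) (V.ρ (Uq.L t d) v) = v := by
  rw [← Module.End.mul_apply, ← map_mul, Uq.Linv_mul_L, map_one, Module.End.one_apply]

lemma ρ_L_Linv (V : TypeOneRep t d) (v : V.carrier) :
    V.ρ (Uq.L t d) (V.ρ (Uq.Linv t d) v) = v := by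
  rw [← Module.End.mul_apply, ← map_mul, Uq.L_mul_Linv, map_one, Module.End.one_apply]

lemma intertwine_of_gen {V W : TypeOneRep t d} (φ : V.carrier →ₗ[𝕜] W.carrier)
    (hE : ∀ v, φ (V.ρ (Uq.E t d) v) = W.ρ (Uq.E t d) (φ v))
    (hF : ∀ v, φ (V.ρ (Uq.F t d) v) = W.ρ (Uq.F t d) (φ v))
    (hL : ∀ v, φ (V.ρ (Uq.L t d) v) = W.ρ (Uq.L t d) (φ v)) (x : Uq t d) (v : V.carrier) :
    φ (V.ρ x v) = W.ρ x (φ v) := by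
  let S : Subalgebra 𝕜 (Uq t d) :=
    { carrier := {x | ∀ v, φ (V.ρ x v) = W.ρ x (φ v)}
      mul_mem' := fun {x y} hx hy v => by
        rw [map_mul, map_mul, Module.End.mul_apply, Module.End.mul_apply, hx, hy]
      add_mem' := fun {x y} hx hy v => by
        rw [map_add, map_add, LinearMap.add_apply, LinearMap.add_apply, map_add, hx, hy]
      algebraMap_mem' := fun r v => by
        simp [Module.algebraMap_end_apply] }
  have key : x ∈ S := by
    refine Uq.subalgebra_eq_top S (fun g => ?_) x
    cases g with
    | E => exact hE
    | F => exact hF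
    | L => exact hL
    | Linv =>
      intro v
      change φ (V.ρ (Uq.Linv t d) v) = W.ρ (Uq.Linv t d) (φ v)
      -- Commuting with `L` implies commuting with its inverse.
      conv_rhs => rw [← ρ_L_Linv V v, hL, ρ_Linv_L]
  exact key v

lemma mem_weightSpace {V : TypeOneRep t d} {n : ℤ} {v : V.carrier} :
    v ∈ V.weightSpace n ↔ V.ρ (Uq.L t d) v = (t : 𝕜) ^ n • v :=
  Module.End.mem_eigenspace_iff

lemma ρ_Linv_apply {V : TypeOneRep t d} {n : ℤ} {v : V.carrier} (hv : v ∈ V.weightSpace n) :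
    V.ρ (Uq.Linv t d) v = ((t : 𝕜) ^ n)⁻¹ • v := by
  conv_rhs => rw [← V.ρ_Linv_L v, mem_weightSpace.1 hv, map_smul, smul_smul,
    inv_mul_cancel₀ (zpow_ne_zero _ t.ne_zero), one_smul]

lemma ρ_pow_apply {V : TypeOneRep t d} {x : Uq t d} {c : 𝕜} {v : V.carrier}
    (h : V.ρ x v = c • v) (k : ℕ) : V.ρ (x ^ k) v = c ^ k • v := by
  rw [map_pow, end_pow_apply h]

lemma ext_weight {V : TypeOneRep t d} {M : Type} [AddCommGroup M] [Module 𝕜 M]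
    {g h : V.carrier →ₗ[𝕜] M} (hgh : ∀ n : ℤ, ∀ v ∈ V.weightSpace n, g v = h v) : g = h := by
  have : (⊤ : Submodule 𝕜 V.carrier) ≤ LinearMap.eqLocus g h := by
    rw [← V.iSup_weight]
    exact iSup_le fun n v hv => hgh n v hv
  exact LinearMap.ext fun v => this (Submodule.mem_top (x := v))

lemma pow_not_root (ht : ∀ n : ℤ, (t : 𝕜) ^ n = 1 → n = 0) (hd : 0 < d) (n : ℤ)
    (h : ((t : 𝕜) ^ d) ^ n = 1) : n = 0 := by
  rw [← zpow_natCast, ← zpow_mul] at h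
  rcases mul_eq_zero.1 (ht _ h) with h | h <;> omega

lemma isQuantumTriple (ht : ∀ n : ℤ, (t : 𝕜) ^ n = 1 → n = 0) (hd : 0 < d)
    (V : TypeOneRep t d) :
    IsQuantumTriple ((t : 𝕜) ^ d) V.weightSpace (V.ρ (Uq.E t d)) (V.ρ (Uq.F t d)) where
  raise {n v} hv := by
    rw [mem_weightSpace] at hv ⊢
    rw [← Module.End.mul_apply, ← map_mul, Uq.L_mul_E, map_smul, map_mul, LinearMap.smul_apply,
      Module.End.mul_apply, hv, map_smul, smul_smul, zpow_add₀ t.ne_zero, mul_comm]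
    norm_cast
  lower {n v} hv := by
    rw [mem_weightSpace] at hv ⊢
    rw [← Module.End.mul_apply, ← map_mul, Uq.L_mul_F, map_smul, map_mul, LinearMap.smul_apply,
      Module.End.mul_apply, hv, map_smul, smul_smul, zpow_sub₀ t.ne_zero, div_eq_mul_inv, mul_comm]
    norm_cast
  comm {n v} hv := by
    have h := LinearMap.congr_fun (congrArg V.ρ (Uq.E_F t d)) v
    simp only [map_sub, map_mul, map_smul, LinearMap.sub_apply, Module.End.mul_apply,
      LinearMap.smul_apply, ρ_pow_apply (mem_weightSpace.1 hv), ρ_pow_apply (ρ_Linv_apply hv),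
      ← sub_smul, smul_smul] at h
    rw [← sub_eq_iff_eq_add', h, qInt]
    congr 3
    · rw [← zpow_natCast, ← zpow_natCast, ← zpow_mul, ← zpow_mul, mul_comm]
    · rw [inv_pow, ← zpow_natCast, ← zpow_natCast, ← zpow_mul, ← zpow_mul, mul_comm]
  bound := by
    obtain ⟨N, hN⟩ := exists_weight_bound ht V
    refine ⟨N, fun n hn => ?_⟩
    by_contra h
    have := Finset.mem_Icc.1 (hN n h)
    omega
  ne_zero := pow_ne_zero _ t.ne_zero
  not_root := pow_not_root ht hd

/-- No analogue for `F` is needed: the action of `F` on a highest weight vector is controlled by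
`IsQuantumTriple.exists_nat_weight`. -/
lemma tensor_E (V W : TypeOneRep t d) (v : V.carrier) (w : W.carrier) :
    (V.tensor W).ρ (Uq.E t d) (v ⊗ₜ[𝕜] w : V.carrier ⊗[𝕜] W.carrier) =
      (V.ρ (Uq.E t d) v ⊗ₜ[𝕜] W.ρ (Uq.L t d ^ d) w + v ⊗ₜ[𝕜] W.ρ (Uq.E t d) w :
        V.carrier ⊗[𝕜] W.carrier) := by
  have h : Uq.comul t d (Uq.E t d) = Uq.E t d ⊗ₜ (Uq.L t d ^ d) + 1 ⊗ₜ Uq.E t d :=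
    Uq.comul_gen t d .E
  change V.tensorρ W (Uq.comul t d (Uq.E t d)) (v ⊗ₜ[𝕜] w) = _
  rw [h, map_add, LinearMap.add_apply, tensorρ_tmul, tensorρ_tmul, TensorProduct.map_tmul,
    TensorProduct.map_tmul, map_one, Module.End.one_apply]

lemma tmul_mem_weightSpace {V W : TypeOneRep t d} {m n : ℤ} {v : V.carrier} {w : W.carrier}
    (hv : v ∈ V.weightSpace m) (hw : w ∈ W.weightSpace n) :
    (v ⊗ₜ[𝕜] w : V.carrier ⊗[𝕜] W.carrier) ∈ (V.tensor W).weightSpace (m + n) := by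
  refine mem_weightSpace.2 ?_
  rw [mem_weightSpace] at hv hw
  have h : Uq.comul t d (Uq.L t d) = Uq.L t d ⊗ₜ Uq.L t d := Uq.comul_gen t d .L
  change V.tensorρ W (Uq.comul t d (Uq.L t d)) (v ⊗ₜ[𝕜] w) = _
  rw [h, tensorρ_tmul, TensorProduct.map_tmul, hv, hw, TensorProduct.tmul_smul,
    ← TensorProduct.smul_tmul', smul_smul, zpow_add₀ t.ne_zero, mul_comm]
  rfl

end TypeOneRep

/-- Weights add in a tensor product, and `a ^ (m + n) = a ^ m * a ^ n`. -/
lemma act_tensor_Ka (ht : ∀ n : ℤ, (t : 𝕜) ^ n = 1 → n = 0) (a : 𝕜ˣ) (V W : TypeOneRep t d) :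
    act (V.tensor W) (Ka ht d a) = TensorProduct.map (act V (Ka ht d a)) (act W (Ka ht d a)) := by
  refine TensorProduct.ext (TypeOneRep.ext_weight fun m v hv =>
    TypeOneRep.ext_weight fun n w hw => ?_)
  change act (V.tensor W) (Ka ht d a) (v ⊗ₜ[𝕜] w : V.carrier ⊗[𝕜] W.carrier) =
    TensorProduct.map (act V (Ka ht d a)) (act W (Ka ht d a)) (v ⊗ₜ[𝕜] w)
  rw [act_Ka ht d a _ _ _ (TypeOneRep.tmul_mem_weightSpace hv hw), TensorProduct.map_tmul,
    act_Ka ht d a _ _ _ hv, act_Ka ht d a _ _ _ hw, TensorProduct.tmul_smul,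
    ← TensorProduct.smul_tmul', smul_smul, zpow_add₀ a.ne_zero, mul_comm]
  rfl

/-- Elements of the completion act on invariant vectors through the counit. -/
lemma act_invariant {V : TypeOneRep t d} {u : V.carrier} (hE : V.ρ (Uq.E t d) u = 0)
    (hF : V.ρ (Uq.F t d) u = 0) (hL : V.ρ (Uq.L t d) u = u) (σ : UqHat t d) :
    act V σ u = counitHat σ • u := by
  have cE : Uq.counit t d (Uq.E t d) = 0 := Uq.counit_gen t d .E
  have cF : Uq.counit t d (Uq.F t d) = 0 := Uq.counit_gen t d .F
  have cL : Uq.counit t d (Uq.L t d) = 1 := Uq.counit_gen t d .L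
  -- An invariant vector is the image of `1` under an intertwiner from the trivial representation.
  have h := act_intertwine (V := TypeOneRep.trivialRep t d) (LinearMap.toSpanSingleton 𝕜 _ u)
    (TypeOneRep.intertwine_of_gen _ (fun c : 𝕜 => ?_) (fun c : 𝕜 => ?_) (fun c : 𝕜 => ?_))
    σ (1 : 𝕜)
  · rw [act_trivialRep] at h
    erw [LinearMap.toSpanSingleton_apply, LinearMap.toSpanSingleton_apply] at h
    rw [mul_one] at h
    exact (congrArg (act V σ) (one_smul 𝕜 u).symm).trans h.symm
  · change (Uq.counit t d (Uq.E t d) * c) • u = V.ρ (Uq.E t d) (c • u)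
    simp [cE, hE]
  · change (Uq.counit t d (Uq.F t d) * c) • u = V.ρ (Uq.F t d) (c • u)
    simp [cF, hF]
  · change (Uq.counit t d (Uq.L t d) * c) • u = V.ρ (Uq.L t d) (c • u)
    simp [cL, hL]

/-! ## The irreducible representations -/

/-- The `k`-th vector of the standard basis of `𝕜 ^ (n + 1)`, zero for `k > n`. -/
def stdVec (𝕜 : Type) [Field 𝕜] (n k : ℕ) : Fin (n + 1) → 𝕜 :=
  fun i => if (i : ℕ) = k then 1 else 0

lemma stdVec_eq_zero {n k : ℕ} (h : n < k) : stdVec 𝕜 n k = 0 := by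
  funext i
  have := i.2
  simp only [stdVec, Pi.zero_apply, ite_eq_right_iff]
  omega

lemma stdVec_eq_single (n : ℕ) (i : Fin (n + 1)) : stdVec 𝕜 n i = Pi.single i 1 := by
  funext j
  simp [stdVec, Pi.single_apply, Fin.ext_iff]

lemma stdVec_zero_ne_zero (n : ℕ) : stdVec 𝕜 n 0 ≠ 0 := by
  intro h
  have := congrFun h 0
  simp [stdVec] at this

lemma sum_smul_stdVec {n : ℕ} (v : Fin (n + 1) → 𝕜) : ∑ i, v i • stdVec 𝕜 n i = v := by
  simp only [stdVec_eq_single]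
  exact (pi_eq_sum_univ' v).symm

lemma ext_stdVec {n : ℕ} {M : Type} [AddCommGroup M] [Module 𝕜 M]
    {g h : (Fin (n + 1) → 𝕜) →ₗ[𝕜] M} (hgh : ∀ k ≤ n, g (stdVec 𝕜 n k) = h (stdVec 𝕜 n k)) :
    g = h := by
  refine LinearMap.ext fun v => ?_
  rw [← sum_smul_stdVec v, map_sum, map_sum]
  refine Finset.sum_congr rfl fun i _ => ?_
  rw [map_smul, map_smul, hgh i (by omega)]

/-- The linear map with prescribed values on the standard basis. -/
def ofStdVec {M : Type} [AddCommGroup M] [Module 𝕜 M] (n : ℕ) (g : ℕ → M) :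
    (Fin (n + 1) → 𝕜) →ₗ[𝕜] M where
  toFun v := ∑ i, v i • g i
  map_add' v w := by simp [add_smul, Finset.sum_add_distrib]
  map_smul' c v := by simp [mul_smul, Finset.smul_sum]

lemma ofStdVec_apply {M : Type} [AddCommGroup M] [Module 𝕜 M] {n : ℕ} {g : ℕ → M} {k : ℕ}
    (hk : n < k → g k = 0) : ofStdVec n g (stdVec 𝕜 n k) = g k := by
  by_cases h : n < k
  · rw [stdVec_eq_zero h, map_zero, hk h]
  · change ∑ i, stdVec 𝕜 n k i • g i = g k
    rw [Finset.sum_eq_single ⟨k, by omega⟩]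
    · simp [stdVec]
    · intro i _ hi
      have : (i : ℕ) ≠ k := fun h => hi (Fin.ext h)
      simp [stdVec, this]
    · simp

/-- The eigenvalue of `F E` on the `k`-th vector of the string of highest weight `n`. -/
def stringCoeff (q : 𝕜) (n : ℕ) (k : ℕ) : 𝕜 := qInt q k * qInt q (n - k + 1)

lemma stringCoeff_zero (q : 𝕜) (n : ℕ) : stringCoeff q n 0 = 0 := by simp [stringCoeff]

lemma stringCoeff_succ_self (q : 𝕜) (n : ℕ) : stringCoeff q n (n + 1) = 0 := by
  simp [stringCoeff]

lemma stringCoeff_ne_zero {q : 𝕜} (hq0 : q ≠ 0) (hq : ∀ n : ℤ, q ^ n = 1 → n = 0) {n k : ℕ}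
    (hk : k < n) : stringCoeff q n (k + 1) ≠ 0 := by
  refine mul_ne_zero (qInt_ne_zero hq0 hq ?_) (qInt_ne_zero hq0 hq ?_) <;> omega

lemma stringCoeff_add {q : 𝕜} (hq0 : q ≠ 0) (hq : ∀ n : ℤ, q ^ n = 1 → n = 0) (n k : ℕ) :
    stringCoeff q n k + qInt q (n - 2 * k) = stringCoeff q n (k + 1) := by
  have := qInt_mul_add hq0 hq k n
  rw [stringCoeff, this, stringCoeff]
  congr 2
  push_cast
  ring

/-- The action of the generators on the irreducible representation of highest weight `n`. -/
def simpleGen (t : 𝕜ˣ) (d n : ℕ) : Gen → Module.End 𝕜 (Fin (n + 1) → 𝕜)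
  -- At `k = 0` the truncated `k - 1` is harmless, since the coefficient vanishes.
  | .E => ofStdVec n fun k => stringCoeff ((t : 𝕜) ^ d) n k • stdVec 𝕜 n (k - 1)
  | .F => ofStdVec n fun k => stdVec 𝕜 n (k + 1)
  | .L => ofStdVec n fun k => (t : 𝕜) ^ ((n : ℤ) - 2 * k) • stdVec 𝕜 n k
  | .Linv => ofStdVec n fun k => ((t : 𝕜) ^ ((n : ℤ) - 2 * k))⁻¹ • stdVec 𝕜 n k

section simpleGen

variable (n k : ℕ)

lemma simpleGen_E_zero : simpleGen t d n .E (stdVec 𝕜 n 0) = 0 :=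
  (ofStdVec_apply fun h => absurd h (by omega)).trans (by simp [stringCoeff_zero])

lemma simpleGen_E_succ : simpleGen t d n .E (stdVec 𝕜 n (k + 1)) =
    stringCoeff ((t : 𝕜) ^ d) n (k + 1) • stdVec 𝕜 n k := by
  refine ofStdVec_apply fun h => ?_
  -- At `k = n` the coefficient contains the factor `[0]`; for `k > n` the vector itself is zero.
  rcases eq_or_lt_of_le (Nat.lt_succ_iff.1 h) with rfl | h
  · simp [stringCoeff_succ_self]
  · simp [stdVec_eq_zero h]

lemma simpleGen_F : simpleGen t d n .F (stdVec 𝕜 n k) = stdVec 𝕜 n (k + 1) :=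
  ofStdVec_apply fun h => stdVec_eq_zero (by omega)

lemma simpleGen_L : simpleGen t d n .L (stdVec 𝕜 n k) =
    (t : 𝕜) ^ ((n : ℤ) - 2 * k) • stdVec 𝕜 n k :=
  ofStdVec_apply fun h => by rw [stdVec_eq_zero h, smul_zero]

lemma simpleGen_Linv : simpleGen t d n .Linv (stdVec 𝕜 n k) =
    ((t : 𝕜) ^ ((n : ℤ) - 2 * k))⁻¹ • stdVec 𝕜 n k :=
  ofStdVec_apply fun h => by rw [stdVec_eq_zero h, smul_zero]

end simpleGen

/-- The only relation with content is the commutator of `E` and `F`, which reduces to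
`stringCoeff_add`. -/
lemma simpleGen_rel (ht : ∀ n : ℤ, (t : 𝕜) ^ n = 1 → n = 0) (hd : 0 < d) (n : ℕ)
    ⦃x y : FreeAlgebra 𝕜 Gen⦄ (h : Rel t d x y) :
    FreeAlgebra.lift 𝕜 (simpleGen t d n) x = FreeAlgebra.lift 𝕜 (simpleGen t d n) y := by
  cases h with
  | L_mul_Linv =>
    refine ext_stdVec fun k _ => ?_
    simp only [map_mul, FreeAlgebra.lift_ι_apply, Module.End.mul_apply, simpleGen_Linv, map_smul,
      simpleGen_L, smul_smul, map_one, Module.End.one_apply]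
    rw [inv_mul_cancel₀ (zpow_ne_zero _ t.ne_zero), one_smul]
  | Linv_mul_L =>
    refine ext_stdVec fun k _ => ?_
    simp only [map_mul, FreeAlgebra.lift_ι_apply, Module.End.mul_apply, simpleGen_Linv, map_smul,
      simpleGen_L, smul_smul, map_one, Module.End.one_apply]
    rw [mul_inv_cancel₀ (zpow_ne_zero _ t.ne_zero), one_smul]
  | L_mul_E =>
    refine ext_stdVec fun k _ => ?_
    cases k with
    | zero =>
      simp [simpleGen_E_zero, simpleGen_L]
    | succ k =>
      simp only [map_mul, FreeAlgebra.lift_ι_apply, Module.End.mul_apply, simpleGen_E_succ,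
        map_smul, simpleGen_L, smul_smul, LinearMap.smul_apply]
      congr 1
      have : (t : 𝕜) ^ ((n : ℤ) - 2 * k) =
          (t : 𝕜) ^ 2 * (t : 𝕜) ^ ((n : ℤ) - 2 * ((k + 1 : ℕ) : ℤ)) := by
        rw [← zpow_natCast, ← zpow_add₀ t.ne_zero]
        congr 1
        push_cast
        ring
      rw [this]
      ring
  | L_mul_F =>
    refine ext_stdVec fun k _ => ?_
    simp only [map_mul, FreeAlgebra.lift_ι_apply, Module.End.mul_apply, simpleGen_F,
      map_smul, simpleGen_L, smul_smul, LinearMap.smul_apply]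
    congr 1
    rw [← zpow_natCast, ← zpow_neg, ← zpow_add₀ t.ne_zero]
    congr 1
    push_cast
    ring
  | E_F =>
    refine ext_stdVec fun k _ => ?_
    have hq0 : (t : 𝕜) ^ d ≠ 0 := pow_ne_zero _ t.ne_zero
    have hq := TypeOneRep.pow_not_root ht hd
    have hFE : simpleGen t d n .F (simpleGen t d n .E (stdVec 𝕜 n k)) =
        stringCoeff ((t : 𝕜) ^ d) n k • stdVec 𝕜 n k := by
      cases k with
      | zero => simp [simpleGen_E_zero, stringCoeff_zero]
      | succ k => rw [simpleGen_E_succ, map_smul, simpleGen_F]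
    simp only [map_mul, map_sub, map_smul, map_pow, FreeAlgebra.lift_ι_apply,
      Module.End.mul_apply, LinearMap.sub_apply, LinearMap.smul_apply, hFE, simpleGen_F,
      simpleGen_E_succ, end_pow_apply (simpleGen_L (t := t) (d := d) n k),
      end_pow_apply (simpleGen_Linv (t := t) (d := d) n k), ← sub_smul, smul_smul]
    congr 1
    rw [sub_eq_iff_eq_add', ← stringCoeff_add hq0 hq, qInt]
    congr 3
    · rw [← zpow_natCast, ← zpow_natCast, ← zpow_mul, ← zpow_mul, mul_comm]
    · rw [inv_pow, ← zpow_natCast, ← zpow_natCast, ← zpow_mul, ← zpow_mul, mul_comm]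

/-- The action of `U_q(sl₂)` on the irreducible representation of highest weight `n`. -/
def simpleρ (ht : ∀ n : ℤ, (t : 𝕜) ^ n = 1 → n = 0) (hd : 0 < d) (n : ℕ) :
    Uq t d →ₐ[𝕜] Module.End 𝕜 (Fin (n + 1) → 𝕜) :=
  RingQuot.liftAlgHom 𝕜 ⟨FreeAlgebra.lift 𝕜 (simpleGen t d n), simpleGen_rel ht hd n⟩

lemma simpleρ_gen (ht : ∀ n : ℤ, (t : 𝕜) ^ n = 1 → n = 0) (hd : 0 < d) (n : ℕ) (g : Gen) :
    simpleρ ht hd n (Uq.gen t d g) = simpleGen t d n g :=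
  (RingQuot.liftAlgHom_mkAlgHom_apply 𝕜 _ (simpleGen_rel ht hd n) _).trans
    (FreeAlgebra.lift_ι_apply _ _)

/-- The irreducible representation of type 1 of highest weight `n`. -/
def simpleRep (ht : ∀ n : ℤ, (t : 𝕜) ^ n = 1 → n = 0) (hd : 0 < d) (n : ℕ) :
    TypeOneRep t d where
  carrier := Fin (n + 1) → 𝕜
  ρ := simpleρ ht hd n
  iSup_weight := by
    rw [Uq.L, simpleρ_gen, eq_top_iff]
    intro v _
    rw [← sum_smul_stdVec v]
    refine sum_mem fun i _ => Submodule.smul_mem _ _ ?_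
    exact Submodule.mem_iSup_of_mem ((n : ℤ) - 2 * (i : ℕ))
      (Module.End.mem_eigenspace_iff.2 (simpleGen_L n i))

namespace simpleRep

variable (ht : ∀ n : ℤ, (t : 𝕜) ^ n = 1 → n = 0) (hd : 0 < d) (n : ℕ)

/-- The basis vectors of the irreducible representation of highest weight `n`. -/
def vec (k : ℕ) : (simpleRep ht hd n).carrier := stdVec 𝕜 n k

lemma E_vec_zero : (simpleRep ht hd n).ρ (Uq.E t d) (vec ht hd n 0) = 0 :=
  (LinearMap.congr_fun (simpleρ_gen ht hd n .E) _).trans (simpleGen_E_zero n)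

lemma E_vec_succ (k : ℕ) : (simpleRep ht hd n).ρ (Uq.E t d) (vec ht hd n (k + 1)) =
    stringCoeff ((t : 𝕜) ^ d) n (k + 1) • vec ht hd n k :=
  (LinearMap.congr_fun (simpleρ_gen ht hd n .E) _).trans (simpleGen_E_succ n k)

lemma F_vec (k : ℕ) : (simpleRep ht hd n).ρ (Uq.F t d) (vec ht hd n k) = vec ht hd n (k + 1) :=
  (LinearMap.congr_fun (simpleρ_gen ht hd n .F) _).trans (simpleGen_F n k)

lemma vec_mem_weightSpace (k : ℕ) :
    vec ht hd n k ∈ (simpleRep ht hd n).weightSpace ((n : ℤ) - 2 * k) :=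
  TypeOneRep.mem_weightSpace.2
    ((LinearMap.congr_fun (simpleρ_gen ht hd n .L) _).trans (simpleGen_L n k))

lemma vec_zero_ne_zero : vec ht hd n 0 ≠ 0 := stdVec_zero_ne_zero n

lemma vec_eq_zero {k : ℕ} (h : n < k) : vec ht hd n k = 0 := stdVec_eq_zero h

lemma exists_sum_vec (v : (simpleRep ht hd n).carrier) :
    ∃ c : Fin (n + 1) → 𝕜, v = ∑ k, c k • vec ht hd n k :=
  ⟨v, (sum_smul_stdVec (n := n) v).symm⟩

variable {n} in
lemma ext_vec {M : Type} [AddCommGroup M] [Module 𝕜 M]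
    {g h : (simpleRep ht hd n).carrier →ₗ[𝕜] M}
    (hgh : ∀ k ≤ n, g (vec ht hd n k) = h (vec ht hd n k)) : g = h :=
  ext_stdVec hgh

/-- The coefficient of `v_k` in `E v` is that of `v_{k+1}` in `v` times a nonzero scalar. -/
lemma ker_E {v : (simpleRep ht hd n).carrier} (hv : (simpleRep ht hd n).ρ (Uq.E t d) v = 0) :
    ∃ c : 𝕜, v = c • vec ht hd n 0 := by
  let w : Fin (n + 1) → 𝕜 := v
  have h : ∑ i, w i • (stringCoeff ((t : 𝕜) ^ d) n i • stdVec 𝕜 n (i - 1)) = 0 :=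
    (LinearMap.congr_fun (simpleρ_gen ht hd n .E) v).symm.trans hv
  refine ⟨w 0, ?_⟩
  change w = w 0 • stdVec 𝕜 n 0
  funext i
  rcases i with ⟨_ | k, hi⟩
  · simp [stdVec]
  · have h1 := congrFun h ⟨k, by omega⟩
    rw [Finset.sum_apply, Finset.sum_eq_single ⟨k + 1, hi⟩] at h1
    · have := stringCoeff_ne_zero (pow_ne_zero d t.ne_zero) (TypeOneRep.pow_not_root ht hd)
        (show k < n by omega)
      simpa [stdVec, this] using h1
    · intro j _ hj
      rcases j with ⟨_ | j, hj'⟩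
      · simp [stringCoeff_zero]
      · have : k ≠ j := by
          rintro rfl
          exact hj rfl
        simp [stdVec, this]
    · simp

/-- Since `E` is nilpotent, a nonzero invariant subspace contains a nonzero vector killed by `E`. By
`ker_E` it contains `v_0`, from which `F` produces the whole basis. -/
lemma isIrreducible : (simpleRep ht hd n).IsIrreducible := by
  refine ⟨⟨vec ht hd n 0, 0, vec_zero_ne_zero ht hd n⟩, fun W hW => ?_⟩
  rw [or_iff_not_imp_left]
  intro hbot
  obtain ⟨v, hvW, hv0⟩ := W.exists_mem_ne_zero_of_ne_bot hbot
  set e := (simpleRep ht hd n).ρ (Uq.E t d) with he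
  have hnil : ∀ k, (e ^ (k + 1)) (vec ht hd n k) = 0 := by
    intro k
    induction k with
    | zero => simpa using E_vec_zero ht hd n
    | succ k ih =>
      rw [pow_succ, Module.End.mul_apply, he, E_vec_succ, map_smul, ← he, ih, smul_zero]
  have hnil' : e ^ (n + 1) = 0 := by
    refine ext_vec ht hd fun k hk => ?_
    obtain ⟨j, rfl⟩ := Nat.exists_eq_add_of_le hk
    rw [show k + j + 1 = j + (k + 1) by ring, pow_add, Module.End.mul_apply, hnil, map_zero,
      LinearMap.zero_apply]
  have hex : ∃ k, (e ^ k) v = 0 := ⟨n + 1, by rw [hnil', LinearMap.zero_apply]⟩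
  classical
  obtain ⟨k, hk⟩ : ∃ k, Nat.find hex = k + 1 :=
    Nat.exists_eq_succ_of_ne_zero fun h0 => hv0 (by simpa using (Nat.find_eq_zero hex).1 h0)
  have h1 : (e ^ (k + 1)) v = 0 := hk ▸ Nat.find_spec hex
  have h2 : (e ^ k) v ≠ 0 := Nat.find_min hex (by omega)
  rw [pow_succ', Module.End.mul_apply] at h1
  have h3 : (e ^ k) v ∈ W := by
    rw [he, ← map_pow]
    exact hW _ _ hvW
  obtain ⟨c, hc⟩ := ker_E ht hd n h1
  have hc0 : c ≠ 0 := by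
    rintro rfl
    exact h2 (by rw [hc, zero_smul])
  rw [hc] at h3
  have h4 : ∀ k, vec ht hd n k ∈ W := by
    intro k
    induction k with
    | zero => exact (W.smul_mem_iff hc0).1 h3
    | succ k ih => rw [← F_vec]; exact hW _ _ ih
  rw [eq_top_iff]
  intro v _
  obtain ⟨c, rfl⟩ := exists_sum_vec ht hd n v
  exact sum_mem fun k _ => W.smul_mem _ (h4 k)

/-- A highest weight vector of weight `n` is the image of that of the irreducible representation
of highest weight `n`. -/
lemma exists_intertwiner (V : TypeOneRep t d) {w : V.carrier} (hw : w ∈ V.weightSpace n)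
    (hE : V.ρ (Uq.E t d) w = 0) :
    ∃ φ : (simpleRep ht hd n).carrier →ₗ[𝕜] V.carrier,
      (∀ x v, φ ((simpleRep ht hd n).ρ x v) = V.ρ x (φ v)) ∧ φ (vec ht hd n 0) = w := by
  have hT := V.isQuantumTriple ht hd
  set e := V.ρ (Uq.E t d)
  set f := V.ρ (Uq.F t d) with hf
  have hn : (f ^ (n + 1)) w = 0 := by
    by_cases hw0 : w = 0
    · rw [hw0, map_zero]
    · obtain ⟨m, hm, h⟩ := hT.exists_nat_weight hw hE hw0
      rw [Nat.cast_inj.1 hm]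
      exact h
  have hk : ∀ k, n < k → (f ^ k) w = 0 := by
    intro k hk
    obtain ⟨j, rfl⟩ := Nat.exists_eq_add_of_le (Nat.succ_le_of_lt hk)
    rw [Nat.succ_eq_add_one, add_comm, pow_add, Module.End.mul_apply, hn, map_zero]
  -- The vanishing of `f ^ k w` for `k > n` makes this map compatible with `F` at the end of the
  -- string.
  let φ : (simpleRep ht hd n).carrier →ₗ[𝕜] V.carrier := ofStdVec n fun k => (f ^ k) w
  have hφ : ∀ k, φ (vec ht hd n k) = (f ^ k) w := fun k => ofStdVec_apply (hk k)
  refine ⟨φ, TypeOneRep.intertwine_of_gen φ ?_ ?_ ?_, ?_⟩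
  · refine LinearMap.congr_fun (f := φ ∘ₗ (simpleRep ht hd n).ρ (Uq.E t d)) (g := e ∘ₗ φ)
      (ext_vec ht hd fun k _ => ?_)
    rw [LinearMap.comp_apply, LinearMap.comp_apply]
    cases k with
    | zero => rw [E_vec_zero, hφ, map_zero, pow_zero, Module.End.one_apply, hE]
    | succ k =>
      rw [E_vec_succ, map_smul, hφ, hφ, hT.e_pow_f hw hE, stringCoeff]
      push_cast
      rw [sub_add_eq_sub_sub, sub_add_cancel]
  · refine LinearMap.congr_fun (f := φ ∘ₗ (simpleRep ht hd n).ρ (Uq.F t d)) (g := f ∘ₗ φ)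
      (ext_vec ht hd fun k _ => ?_)
    rw [LinearMap.comp_apply, LinearMap.comp_apply, F_vec, hφ, hφ, pow_succ', Module.End.mul_apply]
  · refine LinearMap.congr_fun (f := φ ∘ₗ (simpleRep ht hd n).ρ (Uq.L t d))
      (g := V.ρ (Uq.L t d) ∘ₗ φ) (ext_vec ht hd fun k _ => ?_)
    rw [LinearMap.comp_apply, LinearMap.comp_apply,
      TypeOneRep.mem_weightSpace.1 (vec_mem_weightSpace ht hd n k), map_smul, hφ,
      TypeOneRep.mem_weightSpace.1 (hT.pow_f_mem hw k)]
  · rw [hφ, pow_zero, Module.End.one_apply]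

end simpleRep

/-- An element of the completion is determined by its action on the irreducible
representations. -/
lemma ext_act_simpleRep (ht : ∀ n : ℤ, (t : 𝕜) ^ n = 1 → n = 0) (hd : 0 < d)
    {σ τ : UqHat t d} (h : ∀ n, act (simpleRep ht hd n) σ = act (simpleRep ht hd n) τ) :
    σ = τ := by
  refine ext_act fun V => TypeOneRep.ext_weight fun n v hv => ?_
  -- The largest invariant subspace on which `σ` and `τ` agree; it suffices that it contains the
  -- highest weight vectors.
  let S : Submodule 𝕜 V.carrier :=
    ⨅ x : Uq t d, (LinearMap.eqLocus (act V σ) (act V τ)).comap (V.ρ x)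
  have hmem : ∀ v, v ∈ S ↔ ∀ x, act V σ (V.ρ x v) = act V τ (V.ρ x v) := by
    intro v
    simp only [S, Submodule.mem_iInf, Submodule.mem_comap]
    rfl
  have hS : ∀ x, ∀ v ∈ S, V.ρ x v ∈ S := by
    intro x v hv
    rw [hmem] at hv ⊢
    intro y
    rw [← Module.End.mul_apply (V.ρ y), ← map_mul]
    exact hv (y * x)
  have hT := V.isQuantumTriple ht hd
  have key : v ∈ S := by
    refine hT.mem_of_stable (hS _) (hS _) (fun n w hw hE => ?_) hv
    by_cases hw0 : w = 0
    · rw [hw0]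
      exact S.zero_mem
    obtain ⟨m, rfl, -⟩ := hT.exists_nat_weight hw hE hw0
    obtain ⟨φ, hφ, rfl⟩ := simpleRep.exists_intertwiner ht hd m V hw hE
    rw [hmem]
    intro x
    rw [← hφ, ← act_intertwine φ hφ, ← act_intertwine φ hφ, h]
  simpa using (hmem v).1 key 1

/-! ## Grouplike elements -/

/-- A `2 × 2` matrix, with columns `x` and `y`, whose tensor square fixes the quantum
antisymmetric tensor is diagonal of determinant `1`. -/
lemma diagonal_of_fixes_antisymmetric {c : 𝕜} (hc : c ^ 2 ≠ 1) {x y : Fin 2 → 𝕜}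
    (h : x ⊗ₜ[𝕜] y - c • (y ⊗ₜ[𝕜] x) =
      stdVec 𝕜 1 0 ⊗ₜ[𝕜] stdVec 𝕜 1 1 - c • (stdVec 𝕜 1 1 ⊗ₜ[𝕜] stdVec 𝕜 1 0)) :
    x 1 = 0 ∧ y 0 = 0 ∧ x 0 * y 1 = 1 := by
  have hc1 : 1 - c ≠ 0 := fun h0 => hc (by rw [← sub_eq_zero.1 h0, one_pow])
  have key : ∀ i j : Fin 2, x i * y j - c * (y i * x j) =
      stdVec 𝕜 1 0 i * stdVec 𝕜 1 1 j - c * (stdVec 𝕜 1 1 i * stdVec 𝕜 1 0 j) := by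
    intro i j
    have := congrArg (LinearMap.mul' 𝕜 𝕜 ∘ₗ TensorProduct.map
      (LinearMap.proj (R := 𝕜) (φ := fun _ : Fin 2 => 𝕜) i) (LinearMap.proj j)) h
    simpa using this
  have h00 := key 0 0
  have h01 := key 0 1
  have h10 := key 1 0
  have h11 := key 1 1
  simp only [stdVec, Fin.val_zero, Fin.val_one, if_true, zero_ne_one, one_ne_zero, if_false,
    mul_zero, mul_one, sub_zero, zero_sub] at h00 h01 h10 h11
  have h1 : x 0 * y 0 = 0 := by
    refine (mul_eq_zero.1 (?_ : (1 - c) * (x 0 * y 0) = 0)).resolve_left hc1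
    linear_combination h00
  have h2 : x 1 * y 1 = 0 := by
    refine (mul_eq_zero.1 (?_ : (1 - c) * (x 1 * y 1) = 0)).resolve_left hc1
    linear_combination h11
  -- The terms in `x 0 * y 1` cancel in `c * h01 + h10`, leaving a multiple by `1 - c ^ 2`.
  have h3 : y 0 * x 1 = 0 := by
    refine (mul_eq_zero.1 (?_ : (c ^ 2 - 1) * (y 0 * x 1) = 0)).resolve_left (sub_ne_zero.2 hc)
    linear_combination -c * h01 - h10
  have h4 : x 0 * y 1 = 1 := by linear_combination h01 + c * h3
  refine ⟨?_, ?_, h4⟩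
  · exact (mul_eq_zero.1 h2).resolve_right (right_ne_zero_of_mul (h4 ▸ one_ne_zero))
  · exact (mul_eq_zero.1 h1).resolve_left (left_ne_zero_of_mul (h4 ▸ one_ne_zero))

/-! ### From the two-dimensional representation to all irreducibles -/

section

variable (ht : ∀ n : ℤ, (t : 𝕜) ^ n = 1 → n = 0) (hd : 0 < d)

/-- The quantum antisymmetric tensor, an invariant vector. -/
def antisymmetric : ((simpleRep ht hd 1).tensor (simpleRep ht hd 1)).carrier :=
  (simpleRep.vec ht hd 1 0 ⊗ₜ[𝕜] simpleRep.vec ht hd 1 1 -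
    ((t : 𝕜) ^ d)⁻¹ • (simpleRep.vec ht hd 1 1 ⊗ₜ[𝕜] simpleRep.vec ht hd 1 0) :
    (simpleRep ht hd 1).carrier ⊗[𝕜] (simpleRep ht hd 1).carrier)

lemma antisymmetric_mem_weightSpace : antisymmetric ht hd ∈
    ((simpleRep ht hd 1).tensor (simpleRep ht hd 1)).weightSpace 0 := by
  have h0 := simpleRep.vec_mem_weightSpace ht hd 1 0
  have h1 := simpleRep.vec_mem_weightSpace ht hd 1 1
  have h01 := TypeOneRep.tmul_mem_weightSpace h0 h1
  have h10 := TypeOneRep.tmul_mem_weightSpace h1 h0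
  rw [show ((1 : ℕ) : ℤ) - 2 * (0 : ℕ) + ((1 : ℕ) - 2 * (1 : ℕ)) = 0 by norm_num] at h01
  rw [show ((1 : ℕ) : ℤ) - 2 * (1 : ℕ) + ((1 : ℕ) - 2 * (0 : ℕ)) = 0 by norm_num] at h10
  exact Submodule.sub_mem _ h01 (Submodule.smul_mem _ _ h10)

/-- Both terms map to multiples of `v_0 ⊗ v_0`. The factor `q` by which `K` acts on `v_0` in the
second term is cancelled by the coefficient `q⁻¹`. -/
lemma E_antisymmetric : ((simpleRep ht hd 1).tensor (simpleRep ht hd 1)).ρ (Uq.E t d)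
    (antisymmetric ht hd) = 0 := by
  have hq := TypeOneRep.pow_not_root ht hd
  have hq0 : (t : 𝕜) ^ d ≠ 0 := pow_ne_zero _ t.ne_zero
  have h1 : (simpleRep ht hd 1).ρ (Uq.E t d) (simpleRep.vec ht hd 1 1) =
      stringCoeff ((t : 𝕜) ^ d) 1 1 • simpleRep.vec ht hd 1 0 :=
    simpleRep.E_vec_succ ht hd 1 0
  have h2 : (simpleRep ht hd 1).ρ (Uq.L t d ^ d) (simpleRep.vec ht hd 1 0) =
      (t : 𝕜) ^ d • simpleRep.vec ht hd 1 0 := by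
    rw [TypeOneRep.ρ_pow_apply
      (TypeOneRep.mem_weightSpace.1 (simpleRep.vec_mem_weightSpace ht hd 1 0))]
    simp
  have a1 := (simpleRep ht hd 1).tensor_E (simpleRep ht hd 1) (simpleRep.vec ht hd 1 0)
    (simpleRep.vec ht hd 1 1)
  have a2 := (simpleRep ht hd 1).tensor_E (simpleRep ht hd 1) (simpleRep.vec ht hd 1 1)
    (simpleRep.vec ht hd 1 0)
  rw [simpleRep.E_vec_zero, TensorProduct.zero_tmul, zero_add, h1, TensorProduct.tmul_smul] at a1
  rw [simpleRep.E_vec_zero, TensorProduct.tmul_zero, add_zero, h1, h2, TensorProduct.tmul_smul,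
    ← TensorProduct.smul_tmul'] at a2
  refine (map_sub _ _ _).trans ?_
  refine (congrArg₂ _ a1 ((map_smul _ _ _).trans (congrArg _ a2))).trans ?_
  refine (congrArg₂ _ rfl (smul_smul _ _ _)).trans ?_
  rw [inv_mul_cancel₀ hq0]
  exact (congrArg₂ _ rfl (one_smul _ _)).trans (sub_self _)

lemma act_antisymmetric {σ : UqHat t d} (hσ : IsGrouplike σ) :
    act ((simpleRep ht hd 1).tensor (simpleRep ht hd 1)) σ (antisymmetric ht hd) =
      antisymmetric ht hd := by
  have hT := ((simpleRep ht hd 1).tensor (simpleRep ht hd 1)).isQuantumTriple ht hd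
  have hw := antisymmetric_mem_weightSpace ht hd
  have hE := E_antisymmetric ht hd
  by_cases h0 : antisymmetric ht hd = 0
  · rw [h0, map_zero]
  -- A highest weight vector of weight `0` has a string of length one, so `F` kills it too and it is
  -- invariant.
  obtain ⟨m, hm, hF⟩ := hT.exists_nat_weight hw hE h0
  obtain rfl : m = 0 := by omega
  rw [zero_add, pow_one] at hF
  have hL := TypeOneRep.mem_weightSpace.1 hw
  rw [zpow_zero, one_smul] at hL
  rw [act_invariant hE hF hL, hσ.1, one_smul]

lemma exists_act_simpleRep_one {σ : UqHat t d} (hσ : IsGrouplike σ) :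
    ∃ a : 𝕜ˣ, act (simpleRep ht hd 1) σ = act (simpleRep ht hd 1) (Ka ht d a) := by
  have hirr := simpleRep.isIrreducible ht hd 1
  let x : Fin 2 → 𝕜 := act (simpleRep ht hd 1) σ (simpleRep.vec ht hd 1 0)
  let y : Fin 2 → 𝕜 := act (simpleRep ht hd 1) σ (simpleRep.vec ht hd 1 1)
  have h := act_antisymmetric ht hd hσ
  rw [hσ.act_tensor hirr hirr] at h
  have hc : (((t : 𝕜) ^ d)⁻¹) ^ 2 ≠ 1 := by
    intro h
    have h2 := TypeOneRep.pow_not_root ht hd (-2) (by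
      rw [← h, inv_pow, zpow_neg]
      norm_cast)
    omega
  have h' : x ⊗ₜ[𝕜] y - ((t : 𝕜) ^ d)⁻¹ • (y ⊗ₜ[𝕜] x) =
      stdVec 𝕜 1 0 ⊗ₜ[𝕜] stdVec 𝕜 1 1 -
        ((t : 𝕜) ^ d)⁻¹ • (stdVec 𝕜 1 1 ⊗ₜ[𝕜] stdVec 𝕜 1 0) := by
    refine Eq.trans ?_ h
    refine Eq.symm ((map_sub _ _ _).trans ?_)
    exact congrArg₂ _ rfl (map_smul _ _ _)
  obtain ⟨hx, hy, hxy⟩ := diagonal_of_fixes_antisymmetric hc h'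
  -- The scalar `a` is the eigenvalue of `σ` on `v_0`; the determinant condition makes its
  -- eigenvalue on `v_1` the inverse.
  refine ⟨⟨x 0, y 1, hxy, by rw [mul_comm, hxy]⟩, simpleRep.ext_vec ht hd fun k hk => ?_⟩
  rw [act_Ka ht d _ _ _ _ (simpleRep.vec_mem_weightSpace ht hd 1 k)]
  interval_cases k
  · rw [show ((1 : ℕ) : ℤ) - 2 * (0 : ℕ) = 1 by norm_num, zpow_one]
    change x = _
    funext i
    change x i = x 0 * stdVec 𝕜 1 0 i
    fin_cases i <;> simp [stdVec, hx]
  · rw [show ((1 : ℕ) : ℤ) - 2 * (1 : ℕ) = -1 by norm_num, zpow_neg_one, ← Units.val_inv_eq_inv_val]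
    change y = _
    funext i
    change y i = y 1 * stdVec 𝕜 1 1 i
    fin_cases i <;> simp [stdVec, hy]

/-- The vector `v_0 ⊗ v_0` is a nonzero highest weight vector of weight `n + 1`, so it gives an
intertwiner from `V_{n+1}` to `V_1 ⊗ V_n`. This is injective because `V_{n+1}` is irreducible. -/
lemma act_simpleRep_succ {σ τ : UqHat t d} (n : ℕ)
    (h : act ((simpleRep ht hd 1).tensor (simpleRep ht hd n)) σ =
      act ((simpleRep ht hd 1).tensor (simpleRep ht hd n)) τ) :
    act (simpleRep ht hd (n + 1)) σ = act (simpleRep ht hd (n + 1)) τ := by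
  let V := (simpleRep ht hd 1).tensor (simpleRep ht hd n)
  let w : V.carrier := (simpleRep.vec ht hd 1 0 ⊗ₜ[𝕜] simpleRep.vec ht hd n 0 :
    (simpleRep ht hd 1).carrier ⊗[𝕜] (simpleRep ht hd n).carrier)
  have hw : w ∈ V.weightSpace ((n + 1 : ℕ) : ℤ) := by
    have := TypeOneRep.tmul_mem_weightSpace (simpleRep.vec_mem_weightSpace ht hd 1 0)
      (simpleRep.vec_mem_weightSpace ht hd n 0)
    rwa [show ((1 : ℕ) : ℤ) - 2 * (0 : ℕ) + (n - 2 * (0 : ℕ)) = (n + 1 : ℕ) by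
      push_cast; ring] at this
  have hE : V.ρ (Uq.E t d) w = 0 := by
    refine ((simpleRep ht hd 1).tensor_E (simpleRep ht hd n) _ _).trans ?_
    rw [simpleRep.E_vec_zero, simpleRep.E_vec_zero, TensorProduct.zero_tmul,
      TensorProduct.tmul_zero, add_zero]
    rfl
  have hw0 : w ≠ 0 := by
    intro h0
    -- The product of the two zeroth coordinates takes the value `1` on `v_0 ⊗ v_0`.
    have h1 := congrArg (LinearMap.mul' 𝕜 𝕜 ∘ₗ TensorProduct.map
      (LinearMap.proj (R := 𝕜) (φ := fun _ : Fin 2 => 𝕜) 0)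
      (LinearMap.proj (R := 𝕜) (φ := fun _ : Fin (n + 1) => 𝕜) 0)) h0
    have h2 : stdVec 𝕜 1 0 0 * stdVec 𝕜 n 0 0 = 0 := h1.trans (map_zero _)
    simp [stdVec] at h2
  obtain ⟨φ, hφ, hφw⟩ := simpleRep.exists_intertwiner ht hd (n + 1) V hw hE
  have hker : LinearMap.ker φ = ⊥ := by
    refine ((simpleRep.isIrreducible ht hd (n + 1)).2 _ fun x v hv => ?_).resolve_right fun ht' => ?_
    · rw [LinearMap.mem_ker] at hv ⊢
      rw [hφ, hv, map_zero]
    · refine hw0 ?_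
      rw [← hφw]
      exact LinearMap.mem_ker.1 (ht' ▸ Submodule.mem_top)
  refine LinearMap.ext fun v => LinearMap.ker_eq_bot.1 hker ?_
  rw [act_intertwine φ hφ, act_intertwine φ hφ]
  exact LinearMap.congr_fun h _

end

lemma IsGrouplike.exists_eq_Ka (ht : ∀ n : ℤ, (t : 𝕜) ^ n = 1 → n = 0) (hd : 0 < d)
    {σ : UqHat t d} (hσ : IsGrouplike σ) : ∃ a : 𝕜ˣ, σ = Ka ht d a := by
  obtain ⟨a, ha⟩ := exists_act_simpleRep_one ht hd hσ
  refine ⟨a, ext_act_simpleRep ht hd fun n => ?_⟩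
  induction n with
  | zero =>
    -- On `V_0` the only basis vector is invariant, so `σ` fixes it by the counit condition, and
    -- `K_a` acts by `a ^ 0`.
    refine simpleRep.ext_vec ht hd fun k hk => ?_
    obtain rfl : k = 0 := by omega
    have hw := simpleRep.vec_mem_weightSpace ht hd 0 0
    have hF := simpleRep.F_vec ht hd 0 0
    rw [simpleRep.vec_eq_zero ht hd 0 (k := 0 + 1) (by omega)] at hF
    have hL := TypeOneRep.mem_weightSpace.1 hw
    simp only [Nat.cast_zero, mul_zero, sub_zero, zpow_zero, one_smul] at hL
    rw [act_invariant (simpleRep.E_vec_zero ht hd 0) hF hL, hσ.1, act_Ka ht d a _ _ _ hw]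
    simp
  | succ n ih =>
    refine act_simpleRep_succ ht hd n ?_
    rw [hσ.act_tensor (simpleRep.isIrreducible ht hd 1) (simpleRep.isIrreducible ht hd n),
      act_tensor_Ka ht a, ha, ih]

end QuantumSL2

end

/-- Let `m, d ≥ 1`. The ground field is `ℂ(s)`, and `q = s ^ (m * d)`. Every grouplike element of
the completion of `U_q(sl₂)` is `K_a` for some nonzero `a` in the ground field, hence acts on
every vector of weight `n` of every finite-dimensional representation of type 1 by `a ^ n`. The case
`m = d = 1` is that of `U_q(sl₂)` over `ℂ(q)`. -/
theorem mainTheorem10 (m d : ℕ) (hm : 0 < m) (hd : 0 < d)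
    (σ : QuantumSL2.UqHat (QuantumSL2.tPow m) d) (hσ : QuantumSL2.IsGrouplike σ) :
    ∃ a : (RatFunc ℂ)ˣ,
      σ = QuantumSL2.Ka (fun n => QuantumSL2.tPow_zpow_eq_one hm n) d a ∧
      ∀ (V : QuantumSL2.TypeOneRep (QuantumSL2.tPow m) d) (n : ℤ), ∀ v ∈ V.weightSpace n,
        QuantumSL2.act V σ v = (a : RatFunc ℂ) ^ n • v := by 
  obtain ⟨a, rfl⟩ := QuantumSL2.IsGrouplike.exists_eq_Ka
    (fun n => QuantumSL2.tPow_zpow_eq_one hm n) hd hσ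
  exact ⟨a, rfl, QuantumSL2.act_Ka _ d a⟩
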